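/- Let $n\ge 1$, $N\ge 0$ be integers, $\eta,\xi_1,\dots,\xi_N\in\mathbb C$, and let $K$ be a w-simple complex $n\times n$ matrix, i.e. every eigenvalue of $K$ has geometric multiplicity one. Write $K=W_KK_JW_K^{-1}$ with $W_K$ invertible and $K_J$ in upper triangular Jordan form, and let $\mathsf k_1$ be the eigenvalue of the first Jordan block, $K_Je_1=\mathsf k_1e_1$ with $e_1=(1,0,\dots,0)^{T}$; assume $\mathsf k_1\neq 0$. On tensor products of copies of $\mathbb C^n$ let $R_{a,b}(\lambda)=\lambda I+\eta\,\mathbb P_{a,b}$, with $\mathbb P_{a,b}$ the permutation of the factors $a$ and $b$. On $\mathcal H=\bigotimes_{a=1}^N\mathbb C^n$ define the fused transfer matrices, for $1\le m\le n$, $$T_m^{(K)}(\lambda)=\mathrm{tr}_{1,\dots,m}\big[P^-_{1,\dots,m}M_1^{(K)}(\lambda)M_2^{(K)}(\lambda-\eta)\cdots M_m^{(K)}(\lambda-(m-1)\eta)\big],$$ $$M_a^{(K)}(\lambda)=K_aR_{a,N}(\lambda-\xi_N)\cdots R_{a,1}(\lambda-\xi_1),$$ where $1,\dots,m$ label auxiliary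 copies of $\mathbb C^n$ and $P^-_{1,\dots,m}=\frac1{m!}\sum_{\pi\in S_m}\mathrm{sgn}(\pi)P_\pi$ is the antisymmetrizer on them. Put $T_m^{(K,\infty)}=\mathrm{tr}_{1,\dots,m}[P^-_{1,\dots,m}K_1\cdots K_m]$. Then the vector $|t_0\rangle=\big(\bigotimes_{a=1}^NW_{K,a}\big)|0\rangle$, $|0\rangle=\bigotimes_{a=1}^N e_1$, is nonzero, and there are functions $t_{m,0}:\mathbb C\to\mathbb C$, $0\le m\le n$, with $t_{0,0}=1$, such that for all $\lambda\in\mathbb C$: 1. $T_m^{(K)}(\lambda)|t_0\rangle=t_{m,0}(\lambda)|t_0\rangle$ for $1\le m\le n$. 2. $t_{1,0}(\lambda)=\mathsf k_1\prod_{a=1}^N(\lambda-\xi_a+\eta)+(\mathrm{tr}K-\mathsf k_1)\prod_{a=1}^N(\lambda-\xi_a)$. 3. For $1\le m\le n-1$, whenever the denominators do not vanish, i.e. $\xi_a\ne\xi_b$ for $a\neq b$ and $\xi_a\neq\xi_b+r\eta$ for all $a,b$ and $1\le r\le m$, $$t_{m+1,0}(\lambda)=\prod_{b=1}^N\prod_{r=1}^m(\lambda-\xi_b-r\eta)\Big[T_{m+1}^{(K,\infty)}\prod_{b=1}^N(\lambda-\xi_b)+\sum_{a=1}^Ng_a^{(m+1)}(\lambda)\,t_{1,0}(\xi_a)\,t_{m,0}(\xi_a-\eta)\Big],$$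 where $g_a^{(m+1)}(\lambda)=\prod_{b\ne a}\frac{\lambda-\xi_b}{\xi_a-\xi_b}\prod_{b=1}^N\prod_{r=1}^{m}\frac1{\xi_a-\xi_b-r\eta}$. 4. $t_{n,0}(\lambda)=\det K\prod_{b=1}^N\big[(\lambda-\xi_b+\eta)\prod_{r=1}^{n-1}(\lambda-\xi_b-r\eta)\big]$ (the quantum determinant). 5. The $t_{m,0}$ solve the quantum spectral curve with constant $\varphi_t=1$ and $\bar\alpha=\mathsf k_1$: $$\sum_{b=0}^n\alpha_b(\lambda)\,t_{n-b,0}(\lambda-b\eta)=0,$$ where $\alpha_0=-1$, $\alpha_1(\lambda)=\bar\alpha\prod_{a=1}^N(\lambda+\eta-\xi_a)$ and $\alpha_{1+j}(\lambda)=(-1)^j\prod_{h=0}^j\alpha_1(\lambda-h\eta)$ for $1\le j\le n-1$. -/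

import Mathlib

namespace GLChain

/-- `K` is w-simple (its spectrum is non-degenerate, `K` need not be diagonalizable): every
eigenvalue has geometric multiplicity one, i.e. distinct Jordan blocks carry distinct
eigenvalues. -/
def WSimple {n : ℕ} (K : Matrix (Fin n) (Fin n) ℂ) : Prop :=
  ∀ μ : ℂ, Module.finrank ℂ (Module.End.eigenspace (Matrix.toLin' K) μ) ≤ 1

/-- `J` is in upper triangular Jordan form: there are `M` consecutive nonempty blocks
(`blk i` is the number of the block that contains the index `i`), the block number `a` has
`k a` on its diagonal and `1` on its superdiagonal, and all the other entries vanish. -/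
def IsJordanForm {n : ℕ} (J : Matrix (Fin n) (Fin n) ℂ) : Prop :=
  ∃ (M : ℕ) (blk : Fin n → Fin M) (k : Fin M → ℂ),
    Monotone blk ∧ Function.Surjective blk ∧
      J = Matrix.of fun i j =>
        if i = j then k (blk i)
        else if (i : ℕ) + 1 = (j : ℕ) ∧ blk i = blk j then 1
        else 0

section Operators

/-- Operators on the tensor product of copies of `ℂⁿ` labelled by `S`, written as matrices in
the product basis `⊗ₛ e_{x s}`, `x : S → Fin n`. -/
abbrev Op (n : ℕ) (S : Type) : Type := Matrix (S → Fin n) (S → Fin n) ℂ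

variable {n : ℕ} {S : Type} [Fintype S] [DecidableEq S]

/-- The operator `A` acting on the tensor factor `s`, the identity on the others. -/
noncomputable def onSite (s : S) (A : Matrix (Fin n) (Fin n) ℂ) : Op n S :=
  Matrix.of fun x y => if ∀ t, t ≠ s → x t = y t then A (x s) (y s) else 0

/-- The operator `P_π (⊗ₛ v_s) = ⊗ₛ v_{π s}`. -/
noncomputable def permOp (π : Equiv.Perm S) : Op n S :=
  Matrix.of fun x y => if x = y ∘ π then 1 else 0

/-- `R_{a,b}(u) = u I + η ℙ_{a,b}`, acting on the factors `a` and `b`. -/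
noncomputable def rMatrix (η : ℂ) (a b : S) (u : ℂ) : Op n S :=
  u • (1 : Op n S) + η • permOp (Equiv.swap a b)

/-- The twisted monodromy matrix
`M_a(u) = K_a R_{a,N}(u - ξ_N) ⋯ R_{a,1}(u - ξ_1)` with auxiliary factor `a`, where `site j`
is the tensor factor that carries the lattice site `j`. -/
noncomputable def monodromy {N : ℕ} (η : ℂ) (ξ : Fin N → ℂ) (K : Matrix (Fin n) (Fin n) ℂ)
    (site : Fin N → S) (a : S) (u : ℂ) : Op n S :=
  onSite a K * ((List.finRange N).reverse.map fun j => rMatrix η a (site j) (u - ξ j)).prod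

end Operators

variable {n : ℕ}

/-- The antisymmetric projector `P⁻ = (1/m!) ∑_π sgn(π) P_π` on `(ℂⁿ)^{⊗ m}`. -/
noncomputable def antisymmetrizer (n m : ℕ) : Op n (Fin m) :=
  (1 / (Nat.factorial m : ℂ)) •
    ∑ π : Equiv.Perm (Fin m), ((Equiv.Perm.sign π : ℤ) : ℂ) • permOp π

/-- `X ⊗ 1`: an operator on `m` auxiliary factors, extended by the identity to the `N` sites. -/
noncomputable def onAux {m N : ℕ} (X : Op n (Fin m)) : Op n (Fin m ⊕ Fin N) :=
  Matrix.of fun x y =>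
    if x ∘ Sum.inr = y ∘ Sum.inr then X (x ∘ Sum.inl) (y ∘ Sum.inl) else 0

/-- The partial trace over the `m` auxiliary factors. -/
noncomputable def traceAux {m N : ℕ} (X : Op n (Fin m ⊕ Fin N)) : Op n (Fin N) :=
  Matrix.of fun x y => ∑ z : Fin m → Fin n, X (Sum.elim z x) (Sum.elim z y)

/-- The fused transfer matrix
`T_m(u) = tr_{1,…,m} [P⁻ M_1(u) M_2(u - η) ⋯ M_m(u - (m-1)η)]` on `(ℂⁿ)^{⊗ N}`. -/
noncomputable def transfer {N : ℕ} (η : ℂ) (ξ : Fin N → ℂ) (K : Matrix (Fin n) (Fin n) ℂ)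
    (m : ℕ) (u : ℂ) : Op n (Fin N) :=
  traceAux (onAux (antisymmetrizer n m) *
    ((List.finRange m).map fun j =>
      monodromy η ξ K (Sum.inr : Fin N → Fin m ⊕ Fin N) (Sum.inl j) (u - (j : ℕ) * η)).prod)

/-- The asymptotic coefficient `T_m^{(K,∞)} = tr_{1,…,m} [P⁻ K_1 ⋯ K_m]`. -/
noncomputable def transferInfty (K : Matrix (Fin n) (Fin n) ℂ) (m : ℕ) : ℂ :=
  (antisymmetrizer n m * ((List.finRange m).map fun j => onSite j K).prod).trace

/-- `g_a^{(m)}(u)` at `h = 0`: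
`∏_{b ≠ a} (u - ξ_b)/(ξ_a - ξ_b) · ∏_b ∏_{r=1}^{m-1} 1/(ξ_a - (ξ_b + rη))`. -/
noncomputable def gFun {N : ℕ} (η : ℂ) (ξ : Fin N → ℂ) (m : ℕ) (a : Fin N) (u : ℂ) : ℂ :=
  (∏ b ∈ Finset.univ.erase a, (u - ξ b) / (ξ a - ξ b)) *
    ∏ b : Fin N, ∏ r ∈ Finset.Icc 1 (m - 1), 1 / (ξ a - (ξ b + (r : ℂ) * η))

/-- All the denominators of the functions `g_a^{(m)}` at `h = 0` are nonzero. -/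
def GenericUpTo {N : ℕ} (η : ℂ) (ξ : Fin N → ℂ) (m : ℕ) : Prop :=
  (∀ a b, a ≠ b → ξ a ≠ ξ b) ∧
    ∀ a b, ∀ r ∈ Finset.Icc 1 (m - 1), ξ a ≠ ξ b + (r : ℂ) * η

/-- `a(u) = ∏_a (u + η - ξ_a)`. -/
noncomputable def aFun {N : ℕ} (η : ℂ) (ξ : Fin N → ℂ) (u : ℂ) : ℂ :=
  ∏ b : Fin N, (u + η - ξ b)

/-- The coefficients of the quantum spectral curve: `α_0 = -1`, `α_1(u) = ᾱ a(u)`,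
`α_{1+j}(u) = (-1)^j ∏_{h=0}^{j} α_1(u - hη)`. -/
noncomputable def alpha {N : ℕ} (η : ℂ) (ξ : Fin N → ℂ) (abar : ℂ) : ℕ → ℂ → ℂ
  | 0, _ => -1
  | j + 1, u => (-1) ^ j * ∏ h ∈ Finset.range (j + 1), abar * aFun η ξ (u - (h : ℂ) * η)

/-- The quantum spectral curve equation of order `n`:
`∑_{b=0}^{n} α_b(u) φ(u - bη) t_{n-b}(u - bη) = 0` for all `u`. -/
def QuantumSpectralCurve {N : ℕ} (n : ℕ) (η : ℂ) (ξ : Fin N → ℂ) (abar : ℂ) (φ : ℂ → ℂ)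
    (t : ℕ → ℂ → ℂ) : Prop :=
  ∀ u : ℂ, ∑ b ∈ Finset.range (n + 1),
    alpha η ξ abar b u * φ (u - (b : ℂ) * η) * t (n - b) (u - (b : ℂ) * η) = 0

/-- The first vector of the standard basis of `ℂⁿ`. -/
def e₁ [NeZero n] : Fin n → ℂ := Pi.single 0 1

/-- The tensor product vector `⊗_a v_a`. -/
noncomputable def tensorVec {N : ℕ} (v : Fin N → Fin n → ℂ) : (Fin N → Fin n) → ℂ :=
  fun x => ∏ a : Fin N, v a (x a)

/-- `Γ_W = ⊗_a W_a`, the operator `W` acting on every site. -/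
noncomputable def gammaOp (N : ℕ) (W : Matrix (Fin n) (Fin n) ℂ) : Op n (Fin N) :=
  Matrix.of fun x y => ∏ a : Fin N, W (x a) (y a)

/-- The reference vector `|t₀⟩ = Γ_W |0⟩` with `|0⟩ = ⊗_a e₁`. -/
noncomputable def refVector [NeZero n] (N : ℕ) (W : Matrix (Fin n) (Fin n) ℂ) :
    (Fin N → Fin n) → ℂ :=
  (gammaOp N W).mulVec (tensorVec fun _ => e₁)

end GLChain

open GLChain

/-! The twist can be taken triangular. `W` on every auxiliary and every site factor commutes with
permutations and turns the twist `J` into `K`; cyclicity of the partial trace removes the auxiliary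
copies, so `gammaOp` intertwines the transfer matrices of `J` and `K` (`transfer_mul_gammaOp`). It
remains to let the transfer matrix of an upper triangular `J` act on the vector with all site labels
`0`.

At spectral parameter `η` the R-matrix is `η(1 + ℙ)`, so Yang–Baxter becomes the fusion relation
`monodromy_fusion`. It makes the product of shifted monodromies times the antisymmetrizer
antisymmetric in its auxiliary row labels as well as in its column labels. In the partial trace only
injective auxiliary labellings survive, and permuting rows and columns together moves the label `0`,
if it occurs, to the first slot. There the monodromies act by scalars: `a(u) = aFun η ξ u` in the
first slot if its label is `0`, and `d(u) = dFun ξ u` at the shifted arguments otherwise.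
Triangularity kills every term of the antisymmetrizer except the identity
(`prod_apply_comp_perm_eq_zero`).

Summing over labellings gives the closed form `refEigenvalue`. With `e_m` the elementary symmetric
functions of the diagonal entries other than `k₁`, the eigenvalue for `m + 1` is `∏_{r=1}^m d(u -
rη) · (a(u) k₁ e_m + d(u) e_{m+1})`. The remaining claims are algebra: Lagrange interpolation of `a
- d`, whose degree is below `N`; `e_n = 0`; and a telescoping sum based on `a(u - η) = d(u)`. -/

namespace GLChain

set_option linter.unusedSectionVars false

/-! ### Permutation operators, R-matrices and the fusion relation -/

section Tensor

variable {n : ℕ} {S : Type} [Fintype S]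

/-- The tensor product operator `⊗ₛ F s`. -/
noncomputable def tensorOp (F : S → Matrix (Fin n) (Fin n) ℂ) : Op n S :=
  Matrix.of fun x y => ∏ s, F s (x s) (y s)

variable [DecidableEq S]

theorem tensorOp_mul (F G : S → Matrix (Fin n) (Fin n) ℂ) :
    tensorOp F * tensorOp G = tensorOp (F * G) := by
  ext x y
  simp only [tensorOp, Matrix.mul_apply, Matrix.of_apply, Pi.mul_apply]
  rw [Finset.prod_univ_sum, Fintype.piFinset_univ]
  simp only [Finset.prod_mul_distrib]

theorem tensorOp_one : tensorOp (1 : S → Matrix (Fin n) (Fin n) ℂ) = 1 := by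
  ext x y
  simp only [tensorOp, Matrix.of_apply, Pi.one_apply, Matrix.one_apply]
  rw [Finset.prod_ite_zero]
  simp [funext_iff]

theorem onSite_eq_tensorOp (s : S) (A : Matrix (Fin n) (Fin n) ℂ) :
    onSite s A = tensorOp (Function.update 1 s A) := by
  ext x y
  simp only [tensorOp, onSite, Matrix.of_apply]
  rw [← Finset.mul_prod_erase _ _ (Finset.mem_univ s)]
  rw [Finset.prod_congr rfl (g := fun t => if x t = y t then (1 : ℂ) else 0)]
  · rw [Finset.prod_ite_zero]
    simp
  · intro t ht
    rw [Function.update_of_ne (Finset.ne_of_mem_erase ht)]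
    simp [Matrix.one_apply]

theorem permOp_mul_apply (π : Equiv.Perm S) (A : Op n S) (x y : S → Fin n) :
    (permOp π * A : Op n S) x y = A (x ∘ π.symm) y := by
  simp only [permOp, Matrix.mul_apply, Matrix.of_apply, ite_mul, one_mul, zero_mul]
  rw [Finset.sum_eq_single (x ∘ π.symm)]
  · simp [Function.comp_assoc]
  · intro b _ hb
    rw [if_neg]
    rintro rfl
    exact hb (by simp [Function.comp_assoc])
  · simp

theorem mul_permOp_apply (π : Equiv.Perm S) (A : Op n S) (x y : S → Fin n) :
    (A * permOp π : Op n S) x y = A x (y ∘ π) := by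
  simp [permOp, Matrix.mul_apply]

/-- Permutations act on labels by precomposition, so the order of the factors is reversed. -/
theorem permOp_mul_permOp (π σ : Equiv.Perm S) :
    (permOp π * permOp σ : Op n S) = permOp (σ * π) := by
  ext x y
  rw [mul_permOp_apply]
  simp only [permOp, Matrix.of_apply, Function.comp_assoc, Equiv.Perm.coe_mul]
  congr

theorem permOp_one : (permOp 1 : Op n S) = 1 := by
  ext x y
  simp [permOp, Matrix.one_apply]

theorem permOp_swap_mul_self (a b : S) :
    (permOp (Equiv.swap a b) * permOp (Equiv.swap a b) : Op n S) = 1 := by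
  rw [permOp_mul_permOp, Equiv.swap_mul_self, permOp_one]

theorem permOp_mul_tensorOp (π : Equiv.Perm S) (F : S → Matrix (Fin n) (Fin n) ℂ) :
    permOp π * tensorOp F = tensorOp (F ∘ π) * permOp π := by
  ext x y
  rw [permOp_mul_apply, mul_permOp_apply]
  simp only [tensorOp, Matrix.of_apply]
  rw [← Equiv.prod_comp π]
  simp

theorem permOp_mul_onSite (π : Equiv.Perm S) (s : S) (A : Matrix (Fin n) (Fin n) ℂ) :
    permOp π * onSite (π s) A = onSite s A * permOp π := by
  rw [onSite_eq_tensorOp, onSite_eq_tensorOp, permOp_mul_tensorOp]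
  congr 2
  funext t
  rcases eq_or_ne t s with rfl | h
  · simp
  · simp [Function.update_of_ne h, Function.update_of_ne (π.injective.ne h)]

theorem onSite_commute {s t : S} (h : s ≠ t) (A B : Matrix (Fin n) (Fin n) ℂ) :
    Commute (onSite s A) (onSite t B) := by
  simp only [Commute, SemiconjBy, onSite_eq_tensorOp, tensorOp_mul]
  congr 1
  funext r
  rcases eq_or_ne r s with rfl | hs
  · simp [Function.update_of_ne h]
  · simp [Function.update_of_ne hs]

theorem permOp_commute {a b c d : S} (hac : a ≠ c) (had : a ≠ d) (hbc : b ≠ c) (hbd : b ≠ d) :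
    Commute (permOp (Equiv.swap a b) : Op n S) (permOp (Equiv.swap c d)) := by
  simp only [Commute, SemiconjBy, permOp_mul_permOp]
  congr 1
  ext r
  simp only [Equiv.Perm.coe_mul, Function.comp_apply, Equiv.swap_apply_def]
  grind

theorem permOp_swap_commute_onSite {a b c : S} (hac : a ≠ c) (hbc : b ≠ c)
    (A : Matrix (Fin n) (Fin n) ℂ) :
    Commute (permOp (Equiv.swap a b) : Op n S) (onSite c A) := by
  have := permOp_mul_onSite (Equiv.swap a b) c A
  rwa [Equiv.swap_apply_of_ne_of_ne hac.symm hbc.symm] at this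

theorem rMatrix_commute {a b c d : S} (η u v : ℂ) (hac : a ≠ c) (had : a ≠ d) (hbc : b ≠ c)
    (hbd : b ≠ d) : Commute (rMatrix η a b u : Op n S) (rMatrix η c d v) := by
  have h := permOp_commute (n := n) hac had hbc hbd
  unfold rMatrix
  exact ((Commute.one_left _).smul_left u |>.add_left
    (((Commute.one_right _).smul_right v |>.add_right (h.smul_right η)).smul_left η))

theorem rMatrix_commute_onSite {a b c : S} (η u : ℂ) (hac : a ≠ c) (hbc : b ≠ c)
    (A : Matrix (Fin n) (Fin n) ℂ) : Commute (rMatrix η a b u : Op n S) (onSite c A) :=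
  (Commute.one_left _).smul_left u |>.add_left
    ((permOp_swap_commute_onSite hac hbc A).smul_left η)

theorem permOp_swap_commute_rMatrix {a b c d : S} (η v : ℂ) (hac : a ≠ c) (had : a ≠ d)
    (hbc : b ≠ c) (hbd : b ≠ d) :
    Commute (permOp (Equiv.swap a b) : Op n S) (rMatrix η c d v) :=
  (Commute.one_right _).smul_right v |>.add_right
    ((permOp_commute hac had hbc hbd).smul_right η)

/-- The Yang–Baxter equation at the degenerate point `R_{a,b}(η) = η(1 + ℙ_{a,b})`, with `η` divided
out so that `η = 0` is allowed. After expansion only products of transpositions of three letters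
have to be compared. -/
theorem rMatrix_fusion {a b j : S} (hab : a ≠ b) (haj : a ≠ j) (hbj : b ≠ j) (η v : ℂ) :
    (1 + permOp (Equiv.swap a b) : Op n S) * (rMatrix η a j v * rMatrix η b j (v - η)) =
      rMatrix η b j (v - η) * rMatrix η a j v * (1 + permOp (Equiv.swap a b)) := by
  have e1 : (permOp (Equiv.swap a b) * permOp (Equiv.swap a j) : Op n S) =
      permOp (Equiv.swap a j) * permOp (Equiv.swap b j) := by
    simp only [permOp_mul_permOp]; congr 1; ext r
    simp only [Equiv.Perm.coe_mul, Function.comp_apply, Equiv.swap_apply_def]; grind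
  have e2 : (permOp (Equiv.swap b j) * permOp (Equiv.swap a b) : Op n S) =
      permOp (Equiv.swap a j) * permOp (Equiv.swap b j) := by
    simp only [permOp_mul_permOp]; congr 1; ext r
    simp only [Equiv.Perm.coe_mul, Function.comp_apply, Equiv.swap_apply_def]; grind
  have e3 : (permOp (Equiv.swap a b) * permOp (Equiv.swap b j) : Op n S) =
      permOp (Equiv.swap b j) * permOp (Equiv.swap a j) := by
    simp only [permOp_mul_permOp]; congr 1; ext r
    simp only [Equiv.Perm.coe_mul, Function.comp_apply, Equiv.swap_apply_def]; grind
  have e4 : (permOp (Equiv.swap a j) * permOp (Equiv.swap a b) : Op n S) =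
      permOp (Equiv.swap b j) * permOp (Equiv.swap a j) := by
    simp only [permOp_mul_permOp]; congr 1; ext r
    simp only [Equiv.Perm.coe_mul, Function.comp_apply, Equiv.swap_apply_def]; grind
  have e5 : (permOp (Equiv.swap b j) * permOp (Equiv.swap b j) : Op n S) = 1 :=
    permOp_swap_mul_self b j
  unfold rMatrix
  generalize (permOp (Equiv.swap a b) : Op n S) = p at *
  generalize (permOp (Equiv.swap a j) : Op n S) = q at *
  generalize (permOp (Equiv.swap b j) : Op n S) = r at *
  have e6 : q * r * r = q := by rw [mul_assoc, e5, mul_one]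
  have e7 : r * q * p = q := by rw [mul_assoc, e4, ← mul_assoc, e5, one_mul]
  simp only [add_mul, mul_add, one_mul, mul_one, smul_mul_assoc, mul_smul_comm, ← mul_assoc,
    e6, e7, e1, e2, e3, e4]
  module

/-- The product `R_{a,j_k}(u - ξ_{j_k}) ⋯` over a list of lattice sites. -/
noncomputable def rProd {N : ℕ} (η : ℂ) (ξ : Fin N → ℂ) (site : Fin N → S) (a : S) (u : ℂ)
    (L : List (Fin N)) : Op n S :=
  (L.map fun j => rMatrix η a (site j) (u - ξ j)).prod

variable {N : ℕ} {η : ℂ} {ξ : Fin N → ℂ} {site : Fin N → S}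

theorem rProd_cons (a : S) (u : ℂ) (j : Fin N) (L : List (Fin N)) :
    (rProd η ξ site a u (j :: L) : Op n S) =
      rMatrix η a (site j) (u - ξ j) * rProd η ξ site a u L := by
  simp [rProd]

theorem monodromy_eq (K : Matrix (Fin n) (Fin n) ℂ) (a : S) (u : ℂ) :
    monodromy η ξ K site a u = onSite a K * rProd η ξ site a u (List.finRange N).reverse := by
  rfl

theorem commute_rProd (X : Op n S) (a : S) (u : ℂ) (L : List (Fin N))
    (h : ∀ j ∈ L, Commute X (rMatrix η a (site j) (u - ξ j))) :
    Commute X (rProd η ξ site a u L) := by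
  apply Commute.list_prod_right
  intro Y hY
  obtain ⟨j, hj, rfl⟩ := List.mem_map.1 hY
  exact h j hj

/-- The train argument: factors with different auxiliary spaces and different sites commute, so the
two products can be interleaved site by site and the local relation applied to each pair.
Distinctness of the sites in `L` is what permits the interleaving. -/
theorem rProd_fusion {a b : S} (hab : a ≠ b) (ha : ∀ j, a ≠ site j) (hb : ∀ j, b ≠ site j)
    (hs : Function.Injective site) (u : ℂ) (L : List (Fin N)) (hL : L.Nodup) :
    (1 + permOp (Equiv.swap a b) : Op n S) *
        (rProd η ξ site a u L * rProd η ξ site b (u - η) L) =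
      rProd η ξ site b (u - η) L * rProd η ξ site a u L * (1 + permOp (Equiv.swap a b)) := by
  induction L with
  | nil => simp [rProd]
  | cons j L ih =>
    obtain ⟨hj, hL⟩ := List.nodup_cons.1 hL
    have c1 : Commute (rMatrix η b (site j) (u - η - ξ j) : Op n S) (rProd η ξ site a u L) :=
      commute_rProd _ _ _ _ fun i hi => rMatrix_commute _ _ _ hab.symm (hb i) (ha j).symm
        (hs.ne (by rintro rfl; exact hj hi))
    have c2 : Commute (rMatrix η a (site j) (u - ξ j) : Op n S) (rProd η ξ site b (u - η) L) :=
      commute_rProd _ _ _ _ fun i hi => rMatrix_commute _ _ _ hab (ha i) (hb j).symm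
        (hs.ne (by rintro rfl; exact hj hi))
    have hR := rMatrix_fusion (n := n) hab (ha j) (hb j) η (u - ξ j)
    rw [sub_right_comm] at hR
    simp only [rProd_cons]
    generalize (rMatrix η b (site j) (u - η - ξ j) : Op n S) = Rb at *
    generalize (rMatrix η a (site j) (u - ξ j) : Op n S) = Ra at *
    generalize (rProd η ξ site a u L : Op n S) = Ta at *
    generalize (rProd η ξ site b (u - η) L : Op n S) = Tb at *
    generalize (1 + permOp (Equiv.swap a b) : Op n S) = P at *
    calc P * (Ra * Ta * (Rb * Tb)) = P * (Ra * (Ta * Rb) * Tb) := by noncomm_ring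
      _ = P * (Ra * Rb) * (Ta * Tb) := by rw [← c1.eq]; noncomm_ring
      _ = Rb * Ra * (P * (Ta * Tb)) := by rw [hR]; noncomm_ring
      _ = Rb * (Ra * Tb) * Ta * P := by rw [ih hL]; noncomm_ring
      _ = _ := by rw [c2.eq]; noncomm_ring

theorem rProd_commute_onSite {a b : S} (hab : a ≠ b) (hb : ∀ j, b ≠ site j) (u : ℂ)
    (L : List (Fin N)) (A : Matrix (Fin n) (Fin n) ℂ) :
    Commute (onSite b A) (rProd η ξ site a u L) :=
  commute_rProd _ _ _ _ fun j _ => (rMatrix_commute_onSite _ _ hab (hb j).symm _).symm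

theorem monodromy_fusion {a b : S} (hab : a ≠ b) (ha : ∀ j, a ≠ site j) (hb : ∀ j, b ≠ site j)
    (hs : Function.Injective site) (K : Matrix (Fin n) (Fin n) ℂ) (u : ℂ) :
    (1 + permOp (Equiv.swap a b)) *
        (monodromy η ξ K site a u * monodromy η ξ K site b (u - η)) =
      monodromy η ξ K site b (u - η) * monodromy η ξ K site a u *
        (1 + permOp (Equiv.swap a b)) := by
  have hT := rProd_fusion (n := n) (η := η) (ξ := ξ) hab ha hb hs u (List.finRange N).reverse
    (List.nodup_reverse.2 (List.nodup_finRange N))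
  have c1 : Commute (onSite b K) (rProd η ξ site a u (List.finRange N).reverse) :=
    rProd_commute_onSite hab hb _ _ _
  have c2 : Commute (onSite a K) (rProd η ξ site b (u - η) (List.finRange N).reverse) :=
    rProd_commute_onSite hab.symm ha _ _ _
  have hKK := onSite_commute hab K K
  have hPK : (1 + permOp (Equiv.swap a b)) * (onSite a K * onSite b K) =
      onSite a K * onSite b K * (1 + permOp (Equiv.swap a b)) := by
    have h1 := permOp_mul_onSite (Equiv.swap a b) b K
    have h2 := permOp_mul_onSite (Equiv.swap a b) a K
    rw [Equiv.swap_apply_right] at h1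
    rw [Equiv.swap_apply_left] at h2
    rw [add_mul, mul_add, one_mul, mul_one, ← mul_assoc, h1, mul_assoc, h2, ← mul_assoc,
      hKK.eq]
  simp only [monodromy_eq]
  generalize onSite a K = Ka at *
  generalize onSite b K = Kb at *
  generalize (rProd η ξ site a u (List.finRange N).reverse : Op n S) = Ta at *
  generalize (rProd η ξ site b (u - η) (List.finRange N).reverse : Op n S) = Tb at *
  generalize (1 + permOp (Equiv.swap a b) : Op n S) = P at *
  calc P * (Ka * Ta * (Kb * Tb)) = P * (Ka * (Ta * Kb) * Tb) := by noncomm_ring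
    _ = P * (Ka * Kb) * (Ta * Tb) := by rw [← c1.eq]; noncomm_ring
    _ = Ka * Kb * (P * (Ta * Tb)) := by rw [hPK]; noncomm_ring
    _ = Ka * Kb * Tb * Ta * P := by rw [hT]; noncomm_ring
    _ = Kb * (Ka * Tb) * Ta * P := by rw [hKK.eq]; noncomm_ring
    _ = _ := by rw [c2.eq]; noncomm_ring

theorem permOp_swap_commute_monodromy {a b c : S} (hac : a ≠ c) (hbc : b ≠ c)
    (ha : ∀ j, a ≠ site j) (hb : ∀ j, b ≠ site j) (K : Matrix (Fin n) (Fin n) ℂ) (u : ℂ) :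
    Commute (permOp (Equiv.swap a b)) (monodromy η ξ K site c u) :=
  (permOp_swap_commute_onSite hac hbc K).mul_right
    (commute_rProd _ _ _ _ fun j _ => permOp_swap_commute_rMatrix _ _ hac (ha j) hbc (hb j))

end Tensor

end GLChain
namespace GLChain

set_option linter.unusedSectionVars false

/-! ### Antisymmetry of the fused monodromy in the auxiliary labels -/

section Auxiliary

variable {n m N : ℕ}

theorem sum_sumArrow (f : (Fin m ⊕ Fin N → Fin n) → ℂ) :
    ∑ w, f w = ∑ z : Fin m → Fin n, ∑ x : Fin N → Fin n, f (Sum.elim z x) := by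
  rw [← Fintype.sum_prod_type', ← (Equiv.sumArrowEquivProdArrow _ _ _).symm.sum_comp]
  rfl

theorem onAux_mul_apply (A : Op n (Fin m)) (Y : Op n (Fin m ⊕ Fin N)) (z : Fin m → Fin n)
    (x : Fin N → Fin n) (y : Fin m ⊕ Fin N → Fin n) :
    (onAux A * Y : Op n (Fin m ⊕ Fin N)) (Sum.elim z x) y =
      ∑ z', A z z' * Y (Sum.elim z' x) y := by
  rw [Matrix.mul_apply, sum_sumArrow]
  refine Finset.sum_congr rfl fun z' _ => ?_
  rw [Finset.sum_eq_single x (fun b _ hb => by simp [onAux, hb.symm]) (by simp)]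
  simp [onAux]

theorem mul_onAux_apply (A : Op n (Fin m)) (Y : Op n (Fin m ⊕ Fin N)) (z : Fin m → Fin n)
    (x : Fin N → Fin n) (w : Fin m ⊕ Fin N → Fin n) :
    (Y * onAux A : Op n (Fin m ⊕ Fin N)) w (Sum.elim z x) =
      ∑ z', Y w (Sum.elim z' x) * A z' z := by
  rw [Matrix.mul_apply, sum_sumArrow]
  refine Finset.sum_congr rfl fun z' _ => ?_
  rw [Finset.sum_eq_single x (fun b _ hb => by simp [onAux, hb]) (by simp)]
  simp [onAux]

theorem traceAux_onAux_mul_comm (A : Op n (Fin m)) (Y : Op n (Fin m ⊕ Fin N)) :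
    traceAux (onAux A * Y) = traceAux (Y * onAux A) := by
  ext x y
  simp only [traceAux, Matrix.of_apply, onAux_mul_apply, mul_onAux_apply]
  rw [Finset.sum_comm]
  exact Finset.sum_congr rfl fun _ _ => Finset.sum_congr rfl fun _ _ => mul_comm _ _

theorem elim_eta (w : Fin m ⊕ Fin N → Fin n) :
    Sum.elim (w ∘ Sum.inl) (w ∘ Sum.inr) = w := by
  ext (i | i) <;> rfl

theorem onAux_mul (A B : Op n (Fin m)) :
    (onAux (A * B) : Op n (Fin m ⊕ Fin N)) = onAux A * onAux B := by
  ext w y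
  rw [← elim_eta w, onAux_mul_apply]
  by_cases h : w ∘ Sum.inr = y ∘ Sum.inr <;>
    simp [onAux, Matrix.mul_apply, h]

theorem onAux_smul (c : ℂ) (A : Op n (Fin m)) :
    (onAux (c • A) : Op n (Fin m ⊕ Fin N)) = c • onAux A := by
  ext w y
  simp [onAux]

/-- A permutation of the auxiliary factors, fixing the sites. -/
def auxPerm (N : ℕ) (π : Equiv.Perm (Fin m)) : Equiv.Perm (Fin m ⊕ Fin N) :=
  Equiv.sumCongr π (Equiv.refl _)

theorem auxPerm_swap (i j : Fin m) :
    auxPerm N (Equiv.swap i j) = Equiv.swap (Sum.inl i) (Sum.inl j) := by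
  ext (r | r)
  · simp only [auxPerm, Equiv.sumCongr_apply, Sum.map_inl, Equiv.swap_apply_def]
    grind
  · simp [auxPerm, Equiv.swap_apply_def]

theorem elim_comp_auxPerm (π : Equiv.Perm (Fin m)) (z : Fin m → Fin n) (x : Fin N → Fin n) :
    Sum.elim z x ∘ auxPerm N π = Sum.elim (z ∘ π) x := by
  ext (r | r) <;> simp [auxPerm]

theorem onAux_permOp (π : Equiv.Perm (Fin m)) :
    (onAux (permOp π) : Op n (Fin m ⊕ Fin N)) = permOp (auxPerm N π) := by
  ext w y
  rw [← elim_eta w, ← elim_eta y]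
  simp only [onAux, permOp, Matrix.of_apply, elim_comp_auxPerm, Sum.elim_comp_inl,
    Sum.elim_comp_inr, Sum.elim_eq_iff]
  by_cases h₁ : w ∘ Sum.inr = y ∘ Sum.inr <;> by_cases h₂ : w ∘ Sum.inl = (y ∘ Sum.inl) ∘ π <;>
    simp [h₁, h₂]

theorem permOp_mul_antisymmetrizer (σ : Equiv.Perm (Fin m)) :
    permOp σ * antisymmetrizer n m =
      ((Equiv.Perm.sign σ : ℤ) : ℂ) • antisymmetrizer n m := by
  rw [antisymmetrizer, mul_smul_comm, smul_comm]
  congr 1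
  rw [Finset.mul_sum, Finset.smul_sum, ← Equiv.sum_comp (Equiv.mulRight σ)
    (fun π => ((Equiv.Perm.sign σ : ℤ) : ℂ) • ((Equiv.Perm.sign π : ℤ) : ℂ) • permOp π)]
  refine Finset.sum_congr rfl fun π _ => ?_
  rw [mul_smul_comm, permOp_mul_permOp, smul_smul, Equiv.coe_mulRight, ← Int.cast_mul,
    ← Units.val_mul, Equiv.Perm.sign_mul, mul_comm (Equiv.Perm.sign π), ← mul_assoc,
    Int.units_mul_self, one_mul]

theorem antisymmetrizer_mul_permOp (σ : Equiv.Perm (Fin m)) :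
    antisymmetrizer n m * permOp σ =
      ((Equiv.Perm.sign σ : ℤ) : ℂ) • antisymmetrizer n m := by
  rw [antisymmetrizer, smul_mul_assoc, smul_comm]
  congr 1
  rw [Finset.sum_mul, Finset.smul_sum, ← Equiv.sum_comp (Equiv.mulLeft σ)
    (fun π => ((Equiv.Perm.sign σ : ℤ) : ℂ) • ((Equiv.Perm.sign π : ℤ) : ℂ) • permOp π)]
  refine Finset.sum_congr rfl fun π _ => ?_
  rw [smul_mul_assoc, permOp_mul_permOp, smul_smul, Equiv.coe_mulLeft, ← Int.cast_mul,
    ← Units.val_mul, Equiv.Perm.sign_mul, ← mul_assoc, Int.units_mul_self, one_mul]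

theorem onAux_antisymmetrizer :
    (onAux (antisymmetrizer n m) : Op n (Fin m ⊕ Fin N)) = (1 / (Nat.factorial m : ℂ)) •
      ∑ π : Equiv.Perm (Fin m), ((Equiv.Perm.sign π : ℤ) : ℂ) • permOp (auxPerm N π) := by
  simp_rw [← onAux_permOp]
  ext w y
  simp only [antisymmetrizer, onAux, Matrix.of_apply, Matrix.smul_apply, Matrix.sum_apply]
  split_ifs <;> simp

theorem onAux_antisymmetrizer_mul_permOp (σ : Equiv.Perm (Fin m)) :
    (onAux (antisymmetrizer n m) * permOp (auxPerm N σ) : Op n (Fin m ⊕ Fin N)) =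
      ((Equiv.Perm.sign σ : ℤ) : ℂ) • onAux (antisymmetrizer n m) := by
  rw [← onAux_permOp, ← onAux_mul, antisymmetrizer_mul_permOp, onAux_smul]

theorem permOp_mul_onAux_antisymmetrizer (σ : Equiv.Perm (Fin m)) :
    (permOp (auxPerm N σ) * onAux (antisymmetrizer n m) : Op n (Fin m ⊕ Fin N)) =
      ((Equiv.Perm.sign σ : ℤ) : ℂ) • onAux (antisymmetrizer n m) := by
  rw [← onAux_permOp, ← onAux_mul, permOp_mul_antisymmetrizer, onAux_smul]

/-- The product of the shifted monodromy matrices over a list of auxiliary factors. -/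
noncomputable def monodromyProd (η : ℂ) (ξ : Fin N → ℂ) (K : Matrix (Fin n) (Fin n) ℂ) (u : ℂ)
    (L : List (Fin m)) : Op n (Fin m ⊕ Fin N) :=
  (L.map fun j : Fin m => monodromy η ξ K Sum.inr (Sum.inl j) (u - (j : ℕ) * η)).prod

/-- The product `M_1(u) ⋯ M_m(u - (m-1)η) P⁻`. -/
noncomputable def fusedMonodromy (η : ℂ) (ξ : Fin N → ℂ) (K : Matrix (Fin n) (Fin n) ℂ) (m : ℕ)
    (u : ℂ) : Op n (Fin m ⊕ Fin N) :=
  monodromyProd η ξ K u (List.finRange m) * onAux (antisymmetrizer n m)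

variable (η : ℂ) (ξ : Fin N → ℂ) (K : Matrix (Fin n) (Fin n) ℂ) (u : ℂ)

/-- With the projector on the right, column antisymmetry is immediate, and only row antisymmetry has
to be drawn from fusion. -/
theorem transfer_eq_traceAux_fusedMonodromy (m : ℕ) :
    transfer η ξ K m u = traceAux (fusedMonodromy η ξ K m u) :=
  traceAux_onAux_mul_comm _ _

theorem permOp_commute_monodromyProd {i j : Fin m} (L : List (Fin m)) (hi : i ∉ L)
    (hj : j ∉ L) :
    Commute (permOp (Equiv.swap (Sum.inl i) (Sum.inl j)) : Op n (Fin m ⊕ Fin N))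
      (monodromyProd η ξ K u L) := by
  apply Commute.list_prod_right
  intro Y hY
  obtain ⟨k, hk, rfl⟩ := List.mem_map.1 hY
  apply permOp_swap_commute_monodromy
  · rintro ⟨⟩; exact hi hk
  · rintro ⟨⟩; exact hj hk
  · simp
  · simp

theorem finRange_eq_append_adjacent (i : Fin m) :
    ∃ L₁ L₂, List.finRange (m + 1) = L₁ ++ i.castSucc :: i.succ :: L₂ := by
  refine ⟨(List.finRange (m + 1)).take i, (List.finRange (m + 1)).drop (i + 2), ?_⟩
  conv_lhs => rw [← List.take_append_drop i (List.finRange (m + 1))]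
  congr 1
  rw [List.drop_eq_getElem_cons (by simp), List.drop_eq_getElem_cons (by simp)]
  simp [Fin.ext_iff]

/-- The operator `1 + ℙ` for the two neighbours commutes with all the other monodromies and passes
the neighbouring pair by fusion, because their arguments differ by exactly `η`. It finally meets the
antisymmetrizer, which it annihilates. -/
theorem adjacent_swap_mul_fusedMonodromy (i : Fin m) :
    permOp (auxPerm N (Equiv.swap i.castSucc i.succ)) * fusedMonodromy η ξ K (m + 1) u =
      -fusedMonodromy η ξ K (m + 1) u := by
  have hP := permOp_mul_onAux_antisymmetrizer (n := n) (N := N) (Equiv.swap i.castSucc i.succ)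
  have hne : i.castSucc ≠ i.succ := by simp [Fin.ext_iff]
  rw [Equiv.Perm.sign_swap hne, auxPerm_swap] at hP
  obtain ⟨L₁, L₂, hL⟩ := finRange_eq_append_adjacent i
  have hnd := List.nodup_finRange (m + 1)
  rw [hL] at hnd
  have c1 := permOp_commute_monodromyProd η ξ K u (i := i.castSucc) (j := i.succ) L₁
    (by grind) (by grind)
  have c2 := permOp_commute_monodromyProd η ξ K u (i := i.castSucc) (j := i.succ) L₂
    (by grind) (by grind)
  have hM := monodromy_fusion (site := (Sum.inr : Fin N → Fin (m + 1) ⊕ Fin N)) (η := η) (ξ := ξ)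
    (a := Sum.inl i.castSucc) (b := Sum.inl i.succ) (by simpa using hne) (by simp) (by simp)
    Sum.inr_injective K (u - (i : ℕ) * η)
  have hs : u - (i : ℕ) * η - η = u - ((i.succ : Fin (m + 1)) : ℕ) * η := by
    push_cast [Fin.val_succ]; ring
  have hX : monodromyProd η ξ K u (List.finRange (m + 1)) =
      monodromyProd η ξ K u L₁ *
        (monodromy η ξ K Sum.inr (Sum.inl i.castSucc) (u - (i : ℕ) * η) *
          monodromy η ξ K Sum.inr (Sum.inl i.succ) (u - (i : ℕ) * η - η)) *
        monodromyProd η ξ K u L₂ := by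
    rw [hL, hs]
    simp [monodromyProd, mul_assoc]
  rw [eq_neg_iff_add_eq_zero, add_comm (_ * _), ← one_add_mul, auxPerm_swap, fusedMonodromy, hX]
  generalize monodromyProd η ξ K u L₁ = A at *
  generalize monodromyProd η ξ K u L₂ = B at *
  generalize monodromy η ξ K Sum.inr (Sum.inl i.castSucc) (u - (i : ℕ) * η) = Ma at *
  generalize monodromy η ξ K Sum.inr (Sum.inl i.succ) (u - (i : ℕ) * η - η) = Mb at *
  generalize (onAux (antisymmetrizer n (m + 1)) : Op n (Fin (m + 1) ⊕ Fin N)) = Q at *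
  have d1 := (Commute.one_left A).add_left c1
  have d2 := (Commute.one_left B).add_left c2
  have hQ : (1 + permOp (Equiv.swap (Sum.inl i.castSucc) (Sum.inl i.succ))) * Q = 0 := by
    rw [add_mul, one_mul, hP]; simp
  generalize (1 + permOp (Equiv.swap (Sum.inl i.castSucc) (Sum.inl i.succ)) :
    Op n (Fin (m + 1) ⊕ Fin N)) = P at *
  calc P * (A * (Ma * Mb) * B * Q) = P * A * (Ma * Mb) * B * Q := by noncomm_ring
    _ = A * (P * (Ma * Mb)) * B * Q := by rw [d1.eq]; noncomm_ring
    _ = A * Mb * Ma * (P * B) * Q := by rw [hM]; noncomm_ring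
    _ = A * Mb * Ma * B * (P * Q) := by rw [d2.eq]; noncomm_ring
    _ = 0 := by rw [hQ, mul_zero]

theorem auxPerm_mul (π σ : Equiv.Perm (Fin m)) :
    auxPerm N (π * σ) = auxPerm N π * auxPerm N σ := by
  ext (r | r) <;> simp [auxPerm]

theorem permOp_mul_fusedMonodromy (π : Equiv.Perm (Fin m)) :
    permOp (auxPerm N π) * fusedMonodromy η ξ K m u =
      ((Equiv.Perm.sign π : ℤ) : ℂ) • fusedMonodromy η ξ K m u := by
  rcases m with _ | m
  · rw [Subsingleton.elim π 1, show auxPerm N (1 : Equiv.Perm (Fin 0)) = 1 by ext (r | r) <;> rfl,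
      permOp_one]
    simp
  have hπ : π ∈ Submonoid.closure
      (Set.range fun i : Fin m => Equiv.swap i.castSucc i.succ) := by
    rw [Equiv.Perm.mclosure_swap_castSucc_succ]; trivial
  induction hπ using Submonoid.closure_induction with
  | mem π h =>
    obtain ⟨i, rfl⟩ := h
    dsimp only
    rw [adjacent_swap_mul_fusedMonodromy, Equiv.Perm.sign_swap (by simp [Fin.ext_iff])]
    simp
  | one =>
    rw [show auxPerm N (1 : Equiv.Perm (Fin (m + 1))) = 1 by ext (r | r) <;> rfl, permOp_one]
    simp
  | mul π σ _ _ h₁ h₂ =>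
    rw [auxPerm_mul, ← permOp_mul_permOp, mul_assoc, h₁, mul_smul_comm, h₂, smul_smul,
      Equiv.Perm.sign_mul]
    simp

theorem fusedMonodromy_mul_permOp (π : Equiv.Perm (Fin m)) :
    fusedMonodromy η ξ K m u * permOp (auxPerm N π) =
      ((Equiv.Perm.sign π : ℤ) : ℂ) • fusedMonodromy η ξ K m u := by
  rw [fusedMonodromy, mul_assoc, onAux_antisymmetrizer_mul_permOp, mul_smul_comm]

theorem fusedMonodromy_apply_comp (π : Equiv.Perm (Fin m)) (z z' : Fin m → Fin n)
    (x y : Fin N → Fin n) :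
    fusedMonodromy η ξ K m u (Sum.elim (z ∘ π) x) (Sum.elim (z' ∘ π) y) =
      fusedMonodromy η ξ K m u (Sum.elim z x) (Sum.elim z' y) := by
  -- Row and column antisymmetry are read at the same mixed entry `(z ∘ π, z')`; both sides then
  -- equal the same sign times that entry.
  have h₁ := congrFun₂ (permOp_mul_fusedMonodromy η ξ K u π) (Sum.elim (z ∘ π) x)
    (Sum.elim z' y)
  have h₂ := congrFun₂ (fusedMonodromy_mul_permOp η ξ K u π) (Sum.elim (z ∘ π) x)
    (Sum.elim z' y)
  have h₃ : Sum.elim (z ∘ π) x ∘ (auxPerm N π).symm = Sum.elim z x := by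
    rw [← elim_comp_auxPerm, Function.comp_assoc, Equiv.self_comp_symm, Function.comp_id]
  rw [permOp_mul_apply, h₃] at h₁
  rw [mul_permOp_apply, elim_comp_auxPerm] at h₂
  exact h₂.trans h₁.symm

theorem fusedMonodromy_apply_eq_zero {z' : Fin m → Fin n} (hz : ¬ Function.Injective z')
    (w : Fin m ⊕ Fin N → Fin n) (y : Fin N → Fin n) :
    fusedMonodromy η ξ K m u w (Sum.elim z' y) = 0 := by
  obtain ⟨i, j, hij, hne⟩ := Function.not_injective_iff.1 hz
  have h := congrFun₂ (fusedMonodromy_mul_permOp η ξ K u (Equiv.swap i j)) w (Sum.elim z' y)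
  rw [mul_permOp_apply, elim_comp_auxPerm, Equiv.Perm.sign_swap hne,
    show z' ∘ Equiv.swap i j = z' by
      ext r; simp only [Function.comp_apply, Equiv.swap_apply_def]; grind] at h
  simp only [Matrix.smul_apply, smul_eq_mul] at h
  push_cast at h
  linear_combination h / 2

theorem fusedMonodromy_apply (w : Fin m ⊕ Fin N → Fin n) (z : Fin m → Fin n)
    (y : Fin N → Fin n) :
    fusedMonodromy η ξ K m u w (Sum.elim z y) =
      1 / (Nat.factorial m : ℂ) * ∑ π : Equiv.Perm (Fin m), ((Equiv.Perm.sign π : ℤ) : ℂ) *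
        monodromyProd η ξ K u (List.finRange m) w (Sum.elim (z ∘ π) y) := by
  rw [fusedMonodromy, onAux_antisymmetrizer, mul_smul_comm, Finset.mul_sum, Matrix.smul_apply, Matrix.sum_apply,
    smul_eq_mul]
  simp only [mul_smul_comm, Matrix.smul_apply, mul_permOp_apply, elim_comp_auxPerm, smul_eq_mul]

end Auxiliary

end GLChain
namespace GLChain

set_option linter.unusedSectionVars false

/-! ### Matrix entries of one monodromy in a column with all sites at `0` -/

section Entries

variable {n N : ℕ} {S : Type} [Fintype S] [DecidableEq S]

theorem rMatrix_mul_apply (η u : ℂ) (a b : S) (X : Op n S) (w y : S → Fin n) :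
    (rMatrix η a b u * X : Op n S) w y = u * X w y + η * X (w ∘ Equiv.swap a b) y := by
  rw [rMatrix, add_mul, smul_mul_assoc, smul_mul_assoc, one_mul, Matrix.add_apply,
    Matrix.smul_apply, Matrix.smul_apply, permOp_mul_apply]
  simp

theorem onSite_mul_apply (s : S) (A : Matrix (Fin n) (Fin n) ℂ) (X : Op n S) (w y : S → Fin n) :
    (onSite s A * X : Op n S) w y = ∑ c, A (w s) c * X (Function.update w s c) y := by
  rw [Matrix.mul_apply]
  symm
  refine Finset.sum_of_injOn (fun c => Function.update w s c)
    (Function.update_injective w s).injOn (by simp) ?_ ?_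
  · intro v _ hv
    rw [onSite, Matrix.of_apply, if_neg, zero_mul]
    intro h
    refine hv ⟨v s, by simp, ?_⟩
    ext t
    rcases eq_or_ne t s with rfl | ht
    · simp
    · simp [ht, h t ht]
  · intro c _
    simp +contextual [onSite]

variable {η : ℂ} {ξ : Fin N → ℂ} {site : Fin N → S}

theorem rProd_apply_eq_zero {a s : S} (u : ℂ) (L : List (Fin N)) (hs : s ≠ a)
    (hL : ∀ j ∈ L, s ≠ site j) {w y : S → Fin n} (h : w s ≠ y s) :
    rProd η ξ site a u L w y = 0 := by
  induction L generalizing w with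
  | nil => rw [rProd, List.map_nil, List.prod_nil, Matrix.one_apply_ne (fun e => h (by rw [e]))]
  | cons j L ih =>
    rw [rProd_cons, rMatrix_mul_apply, ih (fun i hi => hL i (List.mem_cons_of_mem _ hi)) h,
      ih (fun i hi => hL i (List.mem_cons_of_mem _ hi)), mul_zero, mul_zero, add_zero]
    simpa [Equiv.swap_apply_of_ne_of_ne hs (hL j List.mem_cons_self)] using h

theorem monodromy_apply_eq_zero (K : Matrix (Fin n) (Fin n) ℂ) {a s : S} (u : ℂ) (hs : s ≠ a)
    (hL : ∀ j, s ≠ site j) {w y : S → Fin n} (h : w s ≠ y s) :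
    monodromy η ξ K site a u w y = 0 := by
  rw [monodromy_eq, onSite_mul_apply]
  refine Finset.sum_eq_zero fun c _ => ?_
  rw [rProd_apply_eq_zero u _ hs (fun j _ => hL j) (by simpa [hs] using h), mul_zero]

variable [NeZero n]

theorem rProd_apply_of_zero {a : S} (u : ℂ) (L : List (Fin N)) {y : S → Fin n}
    (hy : ∀ j, y (site j) = 0) (hya : y a = 0) (w : S → Fin n) :
    rProd η ξ site a u L w y =
      (L.map fun j => u + η - ξ j).prod * (1 : Op n S) w y := by
  induction L generalizing w with
  | nil => simp [rProd]
  | cons j L ih =>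
    have h : (1 : Op n S) (w ∘ Equiv.swap a (site j)) y = (1 : Op n S) w y := by
      have e : y ∘ Equiv.swap a (site j) = y := by
        ext t
        simp only [Function.comp_apply, Equiv.swap_apply_def]
        grind
      simp only [Matrix.one_apply]
      congr 1
      apply propext
      constructor
      · rintro rfl
        rw [← e, Function.comp_assoc]
        ext; simp
      · rintro rfl; exact e
    rw [rProd_cons, rMatrix_mul_apply, ih, ih, h, List.map_cons, List.prod_cons]
    ring

/-- An exchange term would put the nonzero auxiliary label on site `j`. No later factor touches that
site, while the column has `0` there, so only the identity part of each R-matrix contributes. -/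
theorem rProd_apply_of_ne_zero {a : S} (u : ℂ) (L : List (Fin N)) (hnd : L.Nodup)
    (ha : ∀ j, a ≠ site j) (hs : Function.Injective site) {w y : S → Fin n}
    (hy : ∀ j, y (site j) = 0) (hw : w a ≠ 0) :
    rProd η ξ site a u L w y =
      (L.map fun j => u - ξ j).prod * (1 : Op n S) w y := by
  induction L with
  | nil => simp [rProd]
  | cons j L ih =>
    obtain ⟨hj, hL⟩ := List.nodup_cons.1 hnd
    rw [rProd_cons, rMatrix_mul_apply, ih hL, List.map_cons, List.prod_cons,
      rProd_apply_eq_zero (s := site j) u L (ha j).symm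
        (fun i hi => hs.ne (by rintro rfl; exact hj hi)) (by simpa [hy j] using hw)]
    ring

/-- `d(u) = ∏_a (u - ξ_a)`. -/
noncomputable def dFun (ξ : Fin N → ℂ) (u : ℂ) : ℂ := ∏ b, (u - ξ b)

theorem prod_map_reverse_finRange (f : Fin N → ℂ) :
    ((List.finRange N).reverse.map f).prod = ∏ b, f b := by
  rw [Fin.prod_univ_def]
  exact ((List.reverse_perm _).map f).prod_eq

theorem monodromy_apply_of_zero (K : Matrix (Fin n) (Fin n) ℂ) {a : S} (u : ℂ)
    {y : S → Fin n} (hy : ∀ j, y (site j) = 0) (hya : y a = 0) (w : S → Fin n) :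
    monodromy η ξ K site a u w y = aFun η ξ u * onSite a K w y := by
  conv_rhs => rw [← mul_one (onSite a K)]
  rw [monodromy_eq, onSite_mul_apply, onSite_mul_apply, Finset.mul_sum]
  refine Finset.sum_congr rfl fun c _ => ?_
  rw [rProd_apply_of_zero u _ hy hya, prod_map_reverse_finRange, aFun]
  ring

theorem monodromy_apply_of_ne_zero {K : Matrix (Fin n) (Fin n) ℂ} (hK : ∀ i, i ≠ 0 → K i 0 = 0)
    {a : S} (u : ℂ) (ha : ∀ j, a ≠ site j) (hs : Function.Injective site) {w y : S → Fin n}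
    (hy : ∀ j, y (site j) = 0) (hw : w a ≠ 0) :
    monodromy η ξ K site a u w y = dFun ξ u * onSite a K w y := by
  conv_rhs => rw [← mul_one (onSite a K)]
  rw [monodromy_eq, onSite_mul_apply, onSite_mul_apply, Finset.mul_sum]
  refine Finset.sum_congr rfl fun c _ => ?_
  rcases eq_or_ne c 0 with rfl | hc
  · simp [hK _ hw]
  rw [rProd_apply_of_ne_zero u _ (List.nodup_reverse.2 (List.nodup_finRange N)) ha hs hy
    (by simpa using hc), prod_map_reverse_finRange, dFun]
  ring

end Entries

/-! ### Matrix entries of products of monodromies -/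

section Products

theorem prod_map_onSite {n : ℕ} {S : Type} [Fintype S] [DecidableEq S]
    (K : Matrix (Fin n) (Fin n) ℂ) (L : List S) (hL : L.Nodup) :
    (L.map fun s => onSite s K).prod = tensorOp fun s => if s ∈ L then K else 1 := by
  induction L with
  | nil =>
    simp only [List.map_nil, List.prod_nil, List.not_mem_nil, if_false]
    exact tensorOp_one.symm
  | cons a L ih =>
    obtain ⟨ha, hL⟩ := List.nodup_cons.1 hL
    rw [List.map_cons, List.prod_cons, ih hL, onSite_eq_tensorOp, tensorOp_mul]
    congr 1
    funext s
    rcases eq_or_ne s a with rfl | hs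
    · simp [ha]
    · simp [hs]

variable {n m N : ℕ}

/-- `K` acting on the auxiliary factors of the list `L`. -/
noncomputable def twistProd (N : ℕ) (K : Matrix (Fin n) (Fin n) ℂ) (L : List (Fin m)) :
    Op n (Fin m ⊕ Fin N) :=
  (L.map fun j => onSite (Sum.inl j) K).prod

theorem twistProd_eq_tensorOp (K : Matrix (Fin n) (Fin n) ℂ) (L : List (Fin m)) (hL : L.Nodup) :
    twistProd N K L = tensorOp (Sum.elim (fun j => if j ∈ L then K else 1) fun _ => 1) := by
  have h := prod_map_onSite K (L.map (Sum.inl : Fin m → Fin m ⊕ Fin N))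
    (hL.map Sum.inl_injective)
  rw [List.map_map] at h
  rw [twistProd]
  refine h.trans ?_
  congr 1
  ext (s | s) <;> simp

theorem twistProd_apply (K : Matrix (Fin n) (Fin n) ℂ) (L : List (Fin m)) (hL : L.Nodup)
    (w y : Fin m ⊕ Fin N → Fin n) :
    twistProd N K L w y =
      (∏ j : Fin m, (if j ∈ L then K else 1) (w (Sum.inl j)) (y (Sum.inl j))) *
        ∏ a : Fin N, (1 : Matrix (Fin n) (Fin n) ℂ) (w (Sum.inr a)) (y (Sum.inr a)) := by
  rw [twistProd_eq_tensorOp K L hL]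
  simp [tensorOp, Fintype.prod_sum_type]

theorem twistProd_apply_eq_zero (K : Matrix (Fin n) (Fin n) ℂ) {L : List (Fin m)} (hL : L.Nodup)
    {w y : Fin m ⊕ Fin N → Fin n} (a : Fin N) (h : w (Sum.inr a) ≠ y (Sum.inr a)) :
    twistProd N K L w y = 0 := by
  rw [twistProd_apply K L hL, Finset.prod_eq_zero (i := a)
    (f := fun a => (1 : Matrix (Fin n) (Fin n) ℂ) (w (Sum.inr a)) (y (Sum.inr a)))
    (Finset.mem_univ a) (Matrix.one_apply_ne h), mul_zero]

theorem twistProd_apply_eq_zero' {K : Matrix (Fin n) (Fin n) ℂ} {L : List (Fin m)}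
    (hL : L.Nodup) {w y : Fin m ⊕ Fin N → Fin n} (j : Fin m)
    (h : (if j ∈ L then K else 1) (w (Sum.inl j)) (y (Sum.inl j)) = 0) :
    twistProd N K L w y = 0 := by
  rw [twistProd_apply K L hL, Finset.prod_eq_zero (i := j)
    (f := fun j => (if j ∈ L then K else 1) (w (Sum.inl j)) (y (Sum.inl j)))
    (Finset.mem_univ j) h, zero_mul]

variable [NeZero n] {η : ℂ} {ξ : Fin N → ℂ} {K : Matrix (Fin n) (Fin n) ℂ}

/-- Each nonzero intermediate term still has all sites at `0`, since the factors further right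
reduce to twists and leave the sites alone. Hence every monodromy again acts as `d` times its twist,
and the scalars come out. -/
theorem monodromyProd_apply_of_ne_zero (hK : ∀ i, i ≠ 0 → K i 0 = 0) (u : ℂ)
    (L : List (Fin m)) (hL : L.Nodup) {w y : Fin m ⊕ Fin N → Fin n}
    (hy : ∀ a, y (Sum.inr a) = 0) (hw : ∀ j ∈ L, w (Sum.inl j) ≠ 0) :
    monodromyProd η ξ K u L w y =
      (L.map fun j : Fin m => dFun ξ (u - (j : ℕ) * η)).prod * twistProd N K L w y := by
  induction L generalizing w with
  | nil => simp [monodromyProd, twistProd]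
  | cons j L ih =>
    obtain ⟨hj, hL⟩ := List.nodup_cons.1 hL
    have e₁ : monodromyProd η ξ K u (j :: L) =
        monodromy η ξ K Sum.inr (Sum.inl j) (u - (j : ℕ) * η) * monodromyProd η ξ K u L := by
      simp [monodromyProd]
    have e₂ : twistProd N K (j :: L) = onSite (Sum.inl j) K * twistProd N K L := by
      simp [twistProd]
    rw [e₁, e₂, Matrix.mul_apply, Matrix.mul_apply, Finset.mul_sum, List.map_cons,
      List.prod_cons]
    refine Finset.sum_congr rfl fun v _ => ?_
    by_cases hv : ∃ i ∈ L, w (Sum.inl i) ≠ v (Sum.inl i)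
    · obtain ⟨i, hi, hne⟩ := hv
      have hij : i ≠ j := by rintro rfl; exact hj hi
      rw [monodromy_apply_eq_zero K _ (s := Sum.inl i) (by simpa using hij) (by simp) hne,
        onSite, Matrix.of_apply, if_neg fun h => hne (h _ (by simpa using hij))]
      simp
    push Not at hv
    rw [ih hL fun i hi => by rw [← hv i hi]; exact hw i (List.mem_cons_of_mem _ hi)]
    by_cases hs : ∃ a : Fin N, v (Sum.inr a) ≠ y (Sum.inr a)
    · obtain ⟨a, ha⟩ := hs
      rw [twistProd_apply_eq_zero K hL a ha]
      simp
    push Not at hs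
    rw [monodromy_apply_of_ne_zero hK _ (by simp) Sum.inr_injective
      (fun a => (hs a).trans (hy a)) (hw j List.mem_cons_self)]
    ring

theorem prod_Icc_one_eq_prod_fin (m : ℕ) (f : ℕ → ℂ) :
    ∏ r ∈ Finset.Icc 1 m, f r = ∏ j : Fin m, f (j + 1) := by
  induction m with
  | zero => simp
  | succ m ih =>
    rw [Finset.prod_Icc_succ_top (by omega), Fin.prod_univ_castSucc, ih]
    simp

/-- Only the first slot may carry the row label `0`, and its factor is leftmost, so it acts after
the others have been reduced to scalars. The condition `hy₀` is automatic when the column labels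
permute the row labels. -/
theorem monodromyProd_finRange_apply (hK : ∀ i, i ≠ 0 → K i 0 = 0) (u : ℂ)
    {w y : Fin (m + 1) ⊕ Fin N → Fin n} (hy : ∀ a, y (Sum.inr a) = 0)
    (hw : ∀ j : Fin m, w (Sum.inl j.succ) ≠ 0)
    (hy₀ : w (Sum.inl 0) = 0 → ∃ j, y (Sum.inl j) = 0) :
    monodromyProd η ξ K u (List.finRange (m + 1)) w y =
      (if w (Sum.inl 0) = 0 then aFun η ξ u else dFun ξ u) *
        (∏ r ∈ Finset.Icc 1 m, dFun ξ (u - (r : ℂ) * η)) *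
          twistProd N K (List.finRange (m + 1)) w y := by
  have hd : ∏ r ∈ Finset.Icc 1 m, dFun ξ (u - (r : ℂ) * η) =
      (((List.finRange m).map Fin.succ).map
        fun j : Fin (m + 1) => dFun ξ (u - (j : ℕ) * η)).prod := by
    rw [List.map_map, ← Fin.prod_univ_def, prod_Icc_one_eq_prod_fin]
    simp
  have hnd := List.nodup_finRange (m + 1)
  rw [List.finRange_succ] at *
  obtain ⟨h0, hL⟩ := List.nodup_cons.1 hnd
  split_ifs with hw0
  · obtain ⟨i, hi⟩ := hy₀ hw0
    rw [hd]
    have hwL : ∀ j ∈ (List.finRange m).map Fin.succ, w (Sum.inl j) ≠ 0 := by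
      intro j hj
      obtain ⟨k, _, rfl⟩ := List.mem_map.1 hj
      exact hw k
    have hall : ∀ j : Fin (m + 1), j ≠ 0 → j ∈ (List.finRange m).map Fin.succ := by
      intro j hj
      obtain ⟨k, rfl⟩ := Fin.exists_succ_eq.2 hj
      simp
    generalize (List.finRange m).map Fin.succ = L at *
    have e₁ : monodromyProd η ξ K u (0 :: L) =
        monodromy η ξ K Sum.inr (Sum.inl 0) u * monodromyProd η ξ K u L := by
      simp [monodromyProd]
    have e₂ : twistProd N K (0 :: L) = onSite (Sum.inl 0) K * twistProd N K L := by
      simp [twistProd]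
    rw [e₁, e₂, Matrix.mul_apply, Matrix.mul_apply, Finset.mul_sum]
    refine Finset.sum_congr rfl fun v _ => ?_
    by_cases hv : ∃ i ∈ L, w (Sum.inl i) ≠ v (Sum.inl i)
    · obtain ⟨i, hi, hne⟩ := hv
      have hij : i ≠ 0 := by rintro rfl; exact h0 hi
      rw [monodromy_apply_eq_zero K _ (s := Sum.inl i) (by simpa using hij) (by simp) hne,
        onSite, Matrix.of_apply, if_neg fun h => hne (h _ (by simpa using hij))]
      simp
    push Not at hv
    have hvL : ∀ j ∈ L, v (Sum.inl j) ≠ 0 := fun j hj => by rw [← hv j hj]; exact hwL j hj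
    rw [monodromyProd_apply_of_ne_zero hK u L hL hy hvL]
    by_cases hs : ∃ a : Fin N, v (Sum.inr a) ≠ y (Sum.inr a)
    · obtain ⟨a, ha⟩ := hs
      rw [twistProd_apply_eq_zero K hL a ha]
      simp
    push Not at hs
    by_cases hv0 : v (Sum.inl 0) = 0
    · rw [monodromy_apply_of_zero K u (fun a => (hs a).trans (hy a)) hv0]
      ring
    -- If the first intermediate label is nonzero, either it differs from the column label, which
    -- the twists on `L` cannot change, or the column label `0` sits in a slot of `L`. There the row
    -- label is nonzero and the first column of `K` gives zero.
    have hz : twistProd N K L v y = 0 := by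
      by_cases hvy : v (Sum.inl 0) = y (Sum.inl 0)
      · have hiL : i ∈ L := hall i (by rintro rfl; exact hv0 (hvy.trans hi))
        refine twistProd_apply_eq_zero' hL i ?_
        rw [if_pos hiL, hi, hK _ (hvL i hiL)]
      · refine twistProd_apply_eq_zero' hL 0 ?_
        rw [if_neg h0, Matrix.one_apply_ne hvy]
    rw [hz]
    simp
  · rw [monodromyProd_apply_of_ne_zero hK u _ hnd hy, List.map_cons, List.prod_cons, hd]
    · simp
    · intro j _
      exact Fin.cases hw0 hw j

end Products

end GLChain
namespace GLChain

set_option linter.unusedSectionVars false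

/-! ### The eigenvalue for an upper triangular twist -/

section Eigenvalue

theorem card_injective_image_eq {α : Type*} [Fintype α] [LinearOrder α] {m : ℕ} {s : Finset α}
    (hs : s.card = m) :
    (Finset.univ.filter fun z : Fin m → α =>
      Function.Injective z ∧ Finset.univ.image z = s).card = m.factorial := by
  have himg : Finset.univ.image (s.orderEmbOfFin hs) = s := by
    ext a
    rw [← Finset.mem_coe (s := s), ← Finset.range_orderEmbOfFin s hs]
    simp
  have h : (Finset.univ.filter fun z : Fin m → α =>
      Function.Injective z ∧ Finset.univ.image z = s) =
      Finset.univ.image fun π : Equiv.Perm (Fin m) => s.orderEmbOfFin hs ∘ π := by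
    ext z
    simp only [Finset.mem_filter, Finset.mem_univ, true_and, Finset.mem_image]
    constructor
    · rintro ⟨hz, hzs⟩
      have hmem : ∀ j, ∃ i, s.orderEmbOfFin hs i = z j := by
        intro j
        have : z j ∈ Finset.univ.image (s.orderEmbOfFin hs) := by
          rw [himg, ← hzs]
          exact Finset.mem_image_of_mem z (Finset.mem_univ j)
        obtain ⟨i, -, hi⟩ := Finset.mem_image.1 this
        exact ⟨i, hi⟩
      choose π hπ using hmem
      have hinj : Function.Injective π := fun i j hij => hz (by rw [← hπ, ← hπ, hij])
      exact ⟨Equiv.ofBijective π (Finite.injective_iff_bijective.1 hinj), funext hπ⟩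
    · rintro ⟨π, rfl⟩
      refine ⟨(s.orderEmbOfFin hs).injective.comp π.injective, ?_⟩
      rw [← Finset.image_image, Finset.image_univ_equiv, himg]
  rw [h, Finset.card_image_of_injective, Finset.card_univ, Fintype.card_perm, Fintype.card_fin]
  intro π σ hπσ
  ext j
  exact congrArg _ ((s.orderEmbOfFin hs).injective (congrFun hπσ j))

/-- Each set of size `m` has `m!` injective enumerations; this factor cancels the normalization of
the antisymmetrizer. -/
theorem sum_injective_image {α : Type*} [Fintype α] [LinearOrder α] (m : ℕ)
    (g : Finset α → ℂ) :
    ∑ z : Fin m → α with Function.Injective z, g (Finset.univ.image z) =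
      (m.factorial : ℂ) * ∑ s ∈ Finset.powersetCard m Finset.univ, g s := by
  rw [Finset.mul_sum, ← Finset.sum_fiberwise_of_maps_to (t := Finset.powersetCard m Finset.univ)
    (g := fun z : Fin m → α => Finset.univ.image z)]
  · refine Finset.sum_congr rfl fun s hs => ?_
    rw [Finset.sum_congr rfl (g := fun _ => g s), Finset.sum_const, Finset.filter_filter,
      card_injective_image_eq (Finset.mem_powersetCard.1 hs).2, nsmul_eq_mul]
    intro z hz
    rw [(Finset.mem_filter.1 hz).2]
  · intro z hz
    rw [Finset.mem_powersetCard, Finset.card_image_of_injective _ (Finset.mem_filter.1 hz).2]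
    simp

variable {n N : ℕ} [NeZero n]

/-- The elementary symmetric polynomials of the diagonal entries other than the first. -/
noncomputable def restEsymm (K : Matrix (Fin n) (Fin n) ℂ) (m : ℕ) : ℂ :=
  ∑ s ∈ Finset.powersetCard m (Finset.univ.erase 0), ∏ i ∈ s, K i i

theorem sum_powersetCard_succ (K : Matrix (Fin n) (Fin n) ℂ) (m : ℕ) (a d : ℂ) :
    ∑ s ∈ Finset.powersetCard (m + 1) (Finset.univ : Finset (Fin n)),
        (if 0 ∈ s then a else d) * ∏ i ∈ s, K i i =
      a * (K 0 0 * restEsymm K m) + d * restEsymm K (m + 1) := by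
  have h0 : (0 : Fin n) ∉ Finset.univ.erase (0 : Fin n) := by simp
  conv_lhs => rw [← Finset.insert_erase (Finset.mem_univ (0 : Fin n))]
  rw [Finset.powersetCard_succ_insert h0, Finset.sum_union, add_comm]
  · congr 1
    · rw [Finset.sum_image, restEsymm, Finset.mul_sum, Finset.mul_sum]
      · refine Finset.sum_congr rfl fun s hs => ?_
        have : (0 : Fin n) ∉ s := fun h => h0 ((Finset.mem_powersetCard.1 hs).1 h)
        rw [if_pos (Finset.mem_insert_self _ _), Finset.prod_insert this]
      · intro s hs t ht hst
        have h1 : (0 : Fin n) ∉ s := fun h => h0 ((Finset.mem_powersetCard.1 hs).1 h)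
        have h2 : (0 : Fin n) ∉ t := fun h => h0 ((Finset.mem_powersetCard.1 ht).1 h)
        rw [← Finset.erase_insert h1, ← Finset.erase_insert h2, hst]
    · rw [restEsymm, Finset.mul_sum]
      refine Finset.sum_congr rfl fun s hs => ?_
      have : (0 : Fin n) ∉ s := fun h => h0 ((Finset.mem_powersetCard.1 hs).1 h)
      rw [if_neg this]
  · rw [Finset.disjoint_left]
    intro s hs hs'
    obtain ⟨t, _, rfl⟩ := Finset.mem_image.1 hs'
    exact h0 ((Finset.mem_powersetCard.1 hs).1 (Finset.mem_insert_self _ _))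

theorem restEsymm_zero (K : Matrix (Fin n) (Fin n) ℂ) : restEsymm K 0 = 1 := by
  simp [restEsymm]

theorem restEsymm_one (K : Matrix (Fin n) (Fin n) ℂ) : restEsymm K 1 = K.trace - K 0 0 := by
  rw [restEsymm, Finset.powersetCard_one, Finset.sum_map, Matrix.trace,
    ← Finset.sum_erase_add _ _ (Finset.mem_univ (0 : Fin n))]
  simp

theorem restEsymm_self (K : Matrix (Fin n) (Fin n) ℂ) : restEsymm K n = 0 := by
  rw [restEsymm, Finset.powersetCard_eq_empty.2, Finset.sum_empty]
  rw [Finset.card_erase_of_mem (Finset.mem_univ _), Finset.card_fin]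
  have := NeZero.pos n
  omega

theorem mul_restEsymm_pred (K : Matrix (Fin n) (Fin n) ℂ) :
    K 0 0 * restEsymm K (n - 1) = ∏ i, K i i := by
  have : (Finset.univ.erase (0 : Fin n)).card = n - 1 := by
    rw [Finset.card_erase_of_mem (Finset.mem_univ _), Finset.card_fin]
  rw [restEsymm, ← this, Finset.powersetCard_self, Finset.sum_singleton,
    Finset.mul_prod_erase _ (fun i => K i i) (Finset.mem_univ _)]

/-- The eigenvalue of the fused transfer matrix on the reference vector. -/
noncomputable def refEigenvalue (η : ℂ) (ξ : Fin N → ℂ) (K : Matrix (Fin n) (Fin n) ℂ) :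
    ℕ → ℂ → ℂ
  | 0, _ => 1
  | m + 1, u => (∏ r ∈ Finset.Icc 1 m, dFun ξ (u - (r : ℂ) * η)) *
      (aFun η ξ u * (K 0 0 * restEsymm K m) + dFun ξ u * restEsymm K (m + 1))

variable {m : ℕ} {K : Matrix (Fin n) (Fin n) ℂ}

/-- A nonzero product forces `z j ≤ z (π j)` for all `j`. Both sides have the same sum over `j`, so
equality holds throughout and injectivity gives `π = 1`. -/
theorem prod_apply_comp_perm_eq_zero (hK : ∀ i j, j < i → K i j = 0) {z : Fin m → Fin n}
    (hz : Function.Injective z) {π : Equiv.Perm (Fin m)} (hπ : π ≠ 1) :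
    ∏ j, K (z j) (z (π j)) = 0 := by
  by_contra h
  rw [← ne_eq, Finset.prod_ne_zero_iff] at h
  have hle : ∀ j ∈ Finset.univ, (z j : ℕ) ≤ (z (π j) : ℕ) := fun j hj =>
    not_lt.1 fun hlt => h j hj (hK _ _ hlt)
  have hsum : ∑ j, (z j : ℕ) = ∑ j, (z (π j) : ℕ) :=
    (Equiv.sum_comp π fun j => (z j : ℕ)).symm
  have heq := (Finset.sum_eq_sum_iff_of_le hle).1 hsum
  exact hπ (Equiv.ext fun j => (hz (Fin.ext (heq j (Finset.mem_univ j)))).symm)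

variable (η : ℂ) (ξ : Fin N → ℂ) (u : ℂ)

theorem fusedMonodromy_apply_diag_of_succ (hK : ∀ i j, j < i → K i j = 0)
    {z : Fin (m + 1) → Fin n} (hz : Function.Injective z) (hz0 : ∀ j : Fin m, z j.succ ≠ 0)
    (x : Fin N → Fin n) :
    fusedMonodromy η ξ K (m + 1) u (Sum.elim z x) (Sum.elim z 0) =
      1 / ((m + 1).factorial : ℂ) * ((if z 0 = 0 then aFun η ξ u else dFun ξ u) *
        (∏ r ∈ Finset.Icc 1 m, dFun ξ (u - (r : ℂ) * η)) *
          ((∏ j, K (z j) (z j)) * ∏ a, (1 : Matrix (Fin n) (Fin n) ℂ) (x a) 0)) := by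
  have hK0 : ∀ i, i ≠ 0 → K i 0 = 0 := fun i hi => hK _ _ (Fin.pos_iff_ne_zero.2 hi)
  rw [fusedMonodromy_apply]
  congr 1
  have key : ∀ π : Equiv.Perm (Fin (m + 1)),
      monodromyProd η ξ K u (List.finRange (m + 1)) (Sum.elim z x) (Sum.elim (z ∘ π) 0) =
        (if z 0 = 0 then aFun η ξ u else dFun ξ u) *
        (∏ r ∈ Finset.Icc 1 m, dFun ξ (u - (r : ℂ) * η)) *
          ((∏ j, K (z j) (z (π j))) * ∏ a, (1 : Matrix (Fin n) (Fin n) ℂ) (x a) 0) := by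
    intro π
    rw [monodromyProd_finRange_apply hK0 u (by simp) (by simpa using hz0)
      (fun h => ⟨π.symm 0, by simpa using h⟩), twistProd_apply _ _ (List.nodup_finRange _)]
    simp only [List.mem_finRange, if_true, Sum.elim_inl, Function.comp_apply]
    rfl
  rw [Finset.sum_eq_single 1]
  · rw [key]; simp
  · intro π _ hπ
    rw [key, prod_apply_comp_perm_eq_zero hK hz hπ]
    simp
  · simp

/-- A simultaneous permutation of rows and columns leaves the entry unchanged and moves the label
`0` to the first slot. The value then depends only on the set of labels. -/
theorem fusedMonodromy_apply_diag (hK : ∀ i j, j < i → K i j = 0)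
    {z : Fin (m + 1) → Fin n} (hz : Function.Injective z) (x : Fin N → Fin n) :
    fusedMonodromy η ξ K (m + 1) u (Sum.elim z x) (Sum.elim z 0) =
      1 / ((m + 1).factorial : ℂ) *
        ((∏ r ∈ Finset.Icc 1 m, dFun ξ (u - (r : ℂ) * η)) *
          (∏ a, (1 : Matrix (Fin n) (Fin n) ℂ) (x a) 0) *
          ((if 0 ∈ Finset.univ.image z then aFun η ξ u else dFun ξ u) *
            ∏ i ∈ Finset.univ.image z, K i i)) := by
  rw [Finset.prod_image hz.injOn]
  by_cases h : ∃ j, z j = 0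
  · obtain ⟨j, hj⟩ := h
    rw [← fusedMonodromy_apply_comp η ξ K u (Equiv.swap 0 j),
      fusedMonodromy_apply_diag_of_succ η ξ u hK (hz.comp (Equiv.swap 0 j).injective)]
    · rw [if_pos (by simpa using hj),
        if_pos (Finset.mem_image.2 ⟨j, Finset.mem_univ j, hj⟩)]
      have := Equiv.prod_comp (Equiv.swap 0 j) fun j => K (z j) (z j)
      simp only [Function.comp_apply, this]
      ring
    · intro i hi
      rw [Function.comp_apply, ← hj] at hi
      have := congrArg (Equiv.swap 0 j) (hz hi)
      simp at this
  · push Not at h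
    rw [fusedMonodromy_apply_diag_of_succ η ξ u hK hz (fun j => h _), if_neg (h 0),
      if_neg (by simpa using h)]
    ring

theorem tensorVec_e₁ : (tensorVec fun _ : Fin N => (e₁ : Fin n → ℂ)) = Pi.single 0 1 := by
  ext x
  simp only [tensorVec, e₁, Pi.single_apply]
  rw [Finset.prod_ite_zero]
  simp [funext_iff]

theorem transfer_apply_zero (hK : ∀ i j, j < i → K i j = 0) (x : Fin N → Fin n) :
    transfer η ξ K (m + 1) u x 0 =
      refEigenvalue η ξ K (m + 1) u * ∏ a, (1 : Matrix (Fin n) (Fin n) ℂ) (x a) 0 := by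
  have hm : ((m + 1).factorial : ℂ) ≠ 0 := by exact_mod_cast (m + 1).factorial_ne_zero
  rw [transfer_eq_traceAux_fusedMonodromy]
  simp only [traceAux, Matrix.of_apply]
  rw [← Finset.sum_filter_add_sum_filter_not Finset.univ Function.Injective,
    Finset.sum_eq_zero (s := Finset.univ.filter fun z => ¬ Function.Injective z)
      fun z hz => fusedMonodromy_apply_eq_zero η ξ K u (Finset.mem_filter.1 hz).2 _ _, add_zero,
    Finset.sum_congr rfl fun z hz =>
      fusedMonodromy_apply_diag η ξ u hK (Finset.mem_filter.1 hz).2 x,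
    ← Finset.mul_sum, ← Finset.mul_sum,
    sum_injective_image (m + 1) fun s =>
      (if 0 ∈ s then aFun η ξ u else dFun ξ u) * ∏ i ∈ s, K i i,
    sum_powersetCard_succ, refEigenvalue]
  generalize ∏ r ∈ Finset.Icc 1 m, dFun ξ (u - (r : ℂ) * η) = p
  field_simp

theorem transfer_mulVec_of_upperTriangular (hK : ∀ i j, j < i → K i j = 0) :
    (transfer η ξ K (m + 1) u).mulVec (tensorVec fun _ => e₁) =
      refEigenvalue η ξ K (m + 1) u • tensorVec fun _ => e₁ := by
  ext x
  rw [Pi.smul_apply, smul_eq_mul, tensorVec_e₁, Matrix.mulVec_single_one, Matrix.col_apply,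
    transfer_apply_zero η ξ u hK]
  congr 1
  simp only [Matrix.one_apply, Pi.single_apply]
  rw [Finset.prod_ite_zero]
  simp [funext_iff]

end Eigenvalue

end GLChain
namespace GLChain

set_option linter.unusedSectionVars false

/-! ### Conjugation of the twist by `W` -/

section Conjugation

variable {n m N : ℕ} {S : Type} [Fintype S] [DecidableEq S] {J K W : Matrix (Fin n) (Fin n) ℂ}

theorem gammaOp_eq_tensorOp (N : ℕ) (W : Matrix (Fin n) (Fin n) ℂ) :
    gammaOp N W = tensorOp fun _ => W := rfl

theorem gammaOp_mul (N : ℕ) (A B : Matrix (Fin n) (Fin n) ℂ) :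
    gammaOp N A * gammaOp N B = gammaOp N (A * B) := tensorOp_mul _ _

theorem gammaOp_one (N : ℕ) : gammaOp N (1 : Matrix (Fin n) (Fin n) ℂ) = 1 := tensorOp_one

theorem tensorOp_const_commute_permOp (W : Matrix (Fin n) (Fin n) ℂ) (π : Equiv.Perm S) :
    Commute (tensorOp fun _ => W : Op n S) (permOp π) :=
  (permOp_mul_tensorOp π fun _ => W).symm

theorem tensorOp_const_semiconj_onSite (h : W * J = K * W) (s : S) :
    SemiconjBy (tensorOp fun _ => W : Op n S) (onSite s J) (onSite s K) := by
  simp only [SemiconjBy, onSite_eq_tensorOp, tensorOp_mul]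
  congr 1
  funext r
  rcases eq_or_ne r s with rfl | hs
  · simpa using h
  · simp [Function.update_of_ne hs]

theorem semiconjBy_list_prod_map {M ι : Type*} [Monoid M] {g : M} {f₁ f₂ : ι → M} (L : List ι)
    (h : ∀ i, SemiconjBy g (f₁ i) (f₂ i)) :
    SemiconjBy g (L.map f₁).prod (L.map f₂).prod := by
  induction L with
  | nil => simp
  | cons i L ih => simpa using (h i).mul_right ih

theorem tensorOp_const_semiconj_monodromy (h : W * J = K * W) (η : ℂ) (ξ : Fin N → ℂ)
    (site : Fin N → S) (a : S) (u : ℂ) :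
    SemiconjBy (tensorOp fun _ => W : Op n S) (monodromy η ξ J site a u) (monodromy η ξ K site a u) :=
  (tensorOp_const_semiconj_onSite h a).mul_right (semiconjBy_list_prod_map _ fun _ =>
    ((Commute.one_right _).smul_right _).add_right
      ((tensorOp_const_commute_permOp W _).smul_right η))

theorem tensorOp_const_semiconj_monodromyProd (h : W * J = K * W) (η : ℂ) (ξ : Fin N → ℂ)
    (u : ℂ) (L : List (Fin m)) :
    SemiconjBy (tensorOp fun _ => W : Op n (Fin m ⊕ Fin N)) (monodromyProd η ξ J u L)
      (monodromyProd η ξ K u L) :=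
  semiconjBy_list_prod_map L fun j => tensorOp_const_semiconj_monodromy h η ξ Sum.inr
    (Sum.inl j) _

theorem transfer_eq_traceAux_mul (η : ℂ) (ξ : Fin N → ℂ) (K : Matrix (Fin n) (Fin n) ℂ) (m : ℕ)
    (u : ℂ) : transfer η ξ K m u =
      traceAux (onAux (antisymmetrizer n m) * monodromyProd η ξ K u (List.finRange m)) := rfl

theorem onAux_tensorOp (F : Fin m → Matrix (Fin n) (Fin n) ℂ) :
    (onAux (tensorOp F) : Op n (Fin m ⊕ Fin N)) = tensorOp (Sum.elim F fun _ => 1) := by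
  ext w y
  simp only [onAux, tensorOp, Matrix.of_apply, Fintype.prod_sum_type, Sum.elim_inl, Sum.elim_inr,
    Matrix.one_apply, Finset.prod_ite_zero]
  by_cases h : w ∘ Sum.inr = y ∘ Sum.inr
  · have : ∀ i : Fin N, w (Sum.inr i) = y (Sum.inr i) := congrFun h
    simp [h, this]
  · have : ¬ ∀ i : Fin N, w (Sum.inr i) = y (Sum.inr i) := fun e => h (funext e)
    simp [h, this]

theorem onAux_one : (onAux 1 : Op n (Fin m ⊕ Fin N)) = 1 := by
  rw [← tensorOp_one, onAux_tensorOp, ← tensorOp_one]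
  congr 1
  ext (s | s) <;> rfl

theorem tensorOp_const_commute_onAux_antisymmetrizer (W : Matrix (Fin n) (Fin n) ℂ) :
    Commute (tensorOp fun _ => W : Op n (Fin m ⊕ Fin N)) (onAux (antisymmetrizer n m)) := by
  rw [onAux_antisymmetrizer]
  exact Commute.smul_right (Commute.sum_right _ _ _ fun π _ =>
    (tensorOp_const_commute_permOp W _).smul_right _) _

theorem tensorOp_elim_one_apply (W : Matrix (Fin n) (Fin n) ℂ) (z z' : Fin m → Fin n)
    (x x' : Fin N → Fin n) :
    tensorOp (Sum.elim (fun _ => 1) fun _ => W) (Sum.elim z x) (Sum.elim z' x') =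
      (1 : Op n (Fin m)) z z' * gammaOp N W x x' := by
  rw [← tensorOp_one]
  simp only [tensorOp, gammaOp, Matrix.of_apply, Fintype.prod_sum_type]
  rfl

theorem gammaOp_mul_traceAux (W : Matrix (Fin n) (Fin n) ℂ) (Y : Op n (Fin m ⊕ Fin N)) :
    gammaOp N W * traceAux Y =
      traceAux (tensorOp (Sum.elim (fun _ => 1) fun _ => W) * Y) := by
  ext x y
  simp only [traceAux, Matrix.of_apply, Matrix.mul_apply, sum_sumArrow, Finset.mul_sum]
  rw [Finset.sum_comm]
  refine Finset.sum_congr rfl fun z _ => ?_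
  rw [Finset.sum_eq_single z]
  · refine Finset.sum_congr rfl fun x' _ => ?_
    rw [tensorOp_elim_one_apply, Matrix.one_apply_eq, one_mul]
  · intro z' _ hz
    refine Finset.sum_eq_zero fun x' _ => ?_
    rw [tensorOp_elim_one_apply, Matrix.one_apply_ne hz.symm]
    simp
  · simp

theorem traceAux_mul_gammaOp (W : Matrix (Fin n) (Fin n) ℂ) (Y : Op n (Fin m ⊕ Fin N)) :
    traceAux Y * gammaOp N W =
      traceAux (Y * tensorOp (Sum.elim (fun _ => 1) fun _ => W)) := by
  ext x y
  simp only [traceAux, Matrix.of_apply, Matrix.mul_apply, sum_sumArrow, Finset.sum_mul]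
  rw [Finset.sum_comm]
  refine Finset.sum_congr rfl fun z _ => ?_
  rw [Finset.sum_eq_single z]
  · refine Finset.sum_congr rfl fun x' _ => ?_
    rw [tensorOp_elim_one_apply, Matrix.one_apply_eq, one_mul]
  · intro z' _ hz
    refine Finset.sum_eq_zero fun x' _ => ?_
    rw [tensorOp_elim_one_apply, Matrix.one_apply_ne hz]
    simp
  · simp

/-- The intertwining holds with `W` on all factors. The auxiliary copies of `W` and of its inverse
`V` meet by cyclicity of the partial trace, and only the site copies remain. -/
theorem transfer_mul_gammaOp (h : W * J = K * W) {V : Matrix (Fin n) (Fin n) ℂ} (hV : V * W = 1)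
    (η : ℂ) (ξ : Fin N → ℂ) (m : ℕ) (u : ℂ) :
    transfer η ξ K m u * gammaOp N W = gammaOp N W * transfer η ξ J m u := by
  have hV' : W * V = 1 := mul_eq_one_comm.1 hV
  have hG : SemiconjBy (tensorOp fun _ => W : Op n (Fin m ⊕ Fin N))
      (onAux (antisymmetrizer n m) * monodromyProd η ξ J u (List.finRange m))
      (onAux (antisymmetrizer n m) * monodromyProd η ξ K u (List.finRange m)) :=
    SemiconjBy.mul_right (tensorOp_const_commute_onAux_antisymmetrizer W)
      (tensorOp_const_semiconj_monodromyProd h η ξ u _)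
  replace hG := hG.eq
  rw [transfer_eq_traceAux_mul, transfer_eq_traceAux_mul, traceAux_mul_gammaOp,
    gammaOp_mul_traceAux]
  generalize onAux (antisymmetrizer n m) * monodromyProd η ξ K u (List.finRange m) = X at *
  generalize onAux (antisymmetrizer n m) * monodromyProd η ξ J u (List.finRange m) = Y at *
  have e₁ : (tensorOp fun _ : Fin m ⊕ Fin N => W) =
      onAux (gammaOp m W) * tensorOp (Sum.elim (fun _ => 1) fun _ => W) := by
    rw [gammaOp_eq_tensorOp, onAux_tensorOp, tensorOp_mul]
    congr 1
    ext (s | s) <;> simp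
  have e₂ : (tensorOp (Sum.elim (fun _ => 1) fun _ => W) : Op n (Fin m ⊕ Fin N)) =
      (tensorOp fun _ => W) * onAux (gammaOp m V) := by
    rw [gammaOp_eq_tensorOp, onAux_tensorOp, tensorOp_mul]
    congr 1
    funext s
    rcases s with s | s <;> simp [hV']
  have e₃ : (onAux (gammaOp m V) * onAux (gammaOp m W) : Op n (Fin m ⊕ Fin N)) = 1 := by
    rw [← onAux_mul, gammaOp_mul, hV, gammaOp_one, onAux_one]
  have e₄ : X * tensorOp (Sum.elim (fun _ => 1) fun _ => W) = onAux (gammaOp m W) *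
      (tensorOp (Sum.elim (fun _ => 1) fun _ => W) * Y * onAux (gammaOp m V)) := by
    rw [← mul_assoc, ← mul_assoc, ← e₁, hG, mul_assoc, ← e₂]
  rw [e₄, traceAux_onAux_mul_comm, mul_assoc, e₃, mul_one]

/-- The asymptotic coefficient is the transfer matrix of a chain without sites, so its value and its
conjugation invariance follow from the general results at `N = 0`, where `a = d = 1`. -/
theorem transferInfty_eq_transfer (η : ℂ) (ξ : Fin 0 → ℂ) (K : Matrix (Fin n) (Fin n) ℂ) (m : ℕ)
    (u : ℂ) (x y : Fin 0 → Fin n) : transferInfty K m = transfer η ξ K m u x y := by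
  have hM : ∀ j : Fin m, monodromy η ξ K (Sum.inr : Fin 0 → Fin m ⊕ Fin 0) (Sum.inl j)
      (u - (j : ℕ) * η) = onAux (onSite j K) := by
    intro j
    rw [monodromy, onSite_eq_tensorOp, onSite_eq_tensorOp, onAux_tensorOp]
    simp only [List.finRange_zero, List.reverse_nil, List.map_nil, List.prod_nil, mul_one]
    congr 1
    funext s
    rcases s with s | s
    · simp [Function.update_apply]
    · exact s.elim0
  have hL : ∀ L : List (Fin m), (L.map fun j => (onAux (onSite j K) : Op n (Fin m ⊕ Fin 0))).prod =
      onAux (L.map fun j => onSite j K).prod := by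
    intro L
    induction L with
    | nil => simp [onAux_one]
    | cons j L ih => simp [ih, onAux_mul]
  rw [transfer]
  simp_rw [hM]
  rw [hL, ← onAux_mul, transferInfty, Matrix.trace]
  simp [traceAux, onAux, Subsingleton.elim x y]

theorem transferInfty_conj (h : W * J = K * W) {V : Matrix (Fin n) (Fin n) ℂ} (hV : V * W = 1)
    (m : ℕ) : transferInfty K m = transferInfty J m := by
  have e := transfer_mul_gammaOp h hV 0 (Fin.elim0 : Fin 0 → ℂ) m 0
  rw [show gammaOp 0 W = 1 by
    ext x y; simp [gammaOp, Matrix.one_apply, Subsingleton.elim x y], mul_one, one_mul] at e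
  rw [transferInfty_eq_transfer 0 Fin.elim0 K m 0 Fin.elim0 Fin.elim0, e,
    ← transferInfty_eq_transfer]

theorem transferInfty_succ [NeZero n] (h : W * J = K * W) {V : Matrix (Fin n) (Fin n) ℂ}
    (hV : V * W = 1) (hJ : ∀ i j, j < i → J i j = 0) (m : ℕ) :
    transferInfty K (m + 1) = J 0 0 * restEsymm J m + restEsymm J (m + 1) := by
  rw [transferInfty_conj h hV,
    transferInfty_eq_transfer 0 (Fin.elim0 : Fin 0 → ℂ) J (m + 1) 0 0 0,
    transfer_apply_zero _ _ _ hJ, refEigenvalue]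
  simp [dFun, aFun]

end Conjugation

end GLChain
namespace GLChain

/-! ### Interpolation, quantum determinant and spectral curve -/

section SpectralCurve

variable {n N : ℕ}

theorem IsJordanForm.apply_eq_zero_of_lt {J : Matrix (Fin n) (Fin n) ℂ} (hJ : IsJordanForm J)
    (i j : Fin n) (h : j < i) : J i j = 0 := by
  obtain ⟨M, blk, k, -, -, rfl⟩ := hJ
  rw [Matrix.of_apply, if_neg h.ne', if_neg]
  rintro ⟨h', -⟩
  have : (j : ℕ) < i := h
  omega

/-- Both `a` and `d` are monic of degree `N`, so `a - d` is recovered from its values at the `N`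
nodes, where `d` vanishes. -/
theorem sum_lagrange_aFun (η : ℂ) (ξ : Fin N → ℂ) (hξ : Function.Injective ξ) (u : ℂ) :
    ∑ a, (∏ b ∈ Finset.univ.erase a, (u - ξ b) / (ξ a - ξ b)) * aFun η ξ (ξ a) =
      aFun η ξ u - dFun ξ u := by
  open Polynomial in
  let p : ℂ[X] := ∏ b, (X - C (ξ b - η))
  open Polynomial in
  let q : ℂ[X] := ∏ b, (X - C (ξ b))
  have hp : p.Monic := Polynomial.monic_prod_X_sub_C _ _
  have hq : q.Monic := Polynomial.monic_prod_X_sub_C _ _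
  have hpd : p.degree = N := by
    simp only [p, Polynomial.degree_prod, Polynomial.degree_X_sub_C]
    simp
  have hqd : q.degree = N := by simp [q, Polynomial.degree_prod]
  have hpe : ∀ v, p.eval v = aFun η ξ v := fun v => by
    simp only [p, aFun, Polynomial.eval_prod, Polynomial.eval_sub, Polynomial.eval_X,
      Polynomial.eval_C]
    exact Finset.prod_congr rfl fun b _ => by ring
  have hqe : ∀ v, q.eval v = dFun ξ v := fun v => by
    simp [q, dFun, Polynomial.eval_prod]
  have hdeg : (p - q).degree < (Finset.univ : Finset (Fin N)).card := by
    rw [Finset.card_fin, ← hpd]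
    exact Polynomial.degree_sub_lt_left (hpd.trans hqd.symm) hp.ne_zero (by rw [hp, hq])
  have h := congrArg (Polynomial.eval u) (Lagrange.eq_interpolate hξ.injOn hdeg)
  rw [Polynomial.eval_sub, hpe, hqe, Lagrange.interpolate_apply, Polynomial.eval_finsetSum] at h
  rw [h]
  refine Finset.sum_congr rfl fun a _ => ?_
  have h0 : dFun ξ (ξ a) = 0 := Finset.prod_eq_zero (Finset.mem_univ a) (sub_self _)
  rw [Polynomial.eval_mul, Polynomial.eval_C, Polynomial.eval_sub, hpe, hqe, h0, sub_zero,
    mul_comm, Lagrange.basis, Polynomial.eval_prod]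
  congr 1
  refine Finset.prod_congr rfl fun b _ => ?_
  simp [Lagrange.basisDivisor, div_eq_inv_mul]

theorem aFun_sub_eta (η : ℂ) (ξ : Fin N → ℂ) (u : ℂ) : aFun η ξ (u - η) = dFun ξ u := by
  simp [aFun, dFun]

theorem dFun_self (ξ : Fin N → ℂ) (a : Fin N) : dFun ξ (ξ a) = 0 :=
  Finset.prod_eq_zero (Finset.mem_univ a) (sub_self _)

theorem prod_Icc_one_eq_prod_range (m : ℕ) (f : ℕ → ℂ) :
    ∏ r ∈ Finset.Icc 1 m, f r = ∏ j ∈ Finset.range m, f (j + 1) := by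
  rw [prod_Icc_one_eq_prod_fin, ← Fin.prod_univ_eq_prod_range fun j => f (j + 1)]

theorem prod_prod_sub_eq_prod_dFun (η : ℂ) (ξ : Fin N → ℂ) (m : ℕ) (u : ℂ) :
    ∏ b, ∏ r ∈ Finset.Icc 1 m, (u - ξ b - (r : ℂ) * η) =
      ∏ r ∈ Finset.Icc 1 m, dFun ξ (u - (r : ℂ) * η) := by
  rw [Finset.prod_comm]
  exact Finset.prod_congr rfl fun r _ => Finset.prod_congr rfl fun b _ => by ring

variable [NeZero n] (η : ℂ) (ξ : Fin N → ℂ) (J : Matrix (Fin n) (Fin n) ℂ)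

theorem refEigenvalue_one (u : ℂ) : refEigenvalue η ξ J 1 u =
    J 0 0 * ∏ a, (u - ξ a + η) + (J.trace - J 0 0) * ∏ a, (u - ξ a) := by
  have h : aFun η ξ u = ∏ a, (u - ξ a + η) :=
    Finset.prod_congr rfl fun a _ => by ring
  rw [refEigenvalue, restEsymm_zero, restEsymm_one, h, dFun]
  simp only [Order.lt_one_iff, Finset.Icc_eq_empty_of_lt, Finset.prod_empty]
  ring

/-- Here `a(ξ_a - η) = d(ξ_a) = 0` removes one term. The surviving `d` factors are exactly the
shifted denominators of `gFun` for the next index, `m + 2`. -/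
theorem refEigenvalue_sub_eta (m : ℕ) (a : Fin N) :
    refEigenvalue η ξ J (m + 1) (ξ a - η) =
      (∏ r ∈ Finset.Icc 1 (m + 1), dFun ξ (ξ a - (r : ℂ) * η)) * restEsymm J (m + 1) := by
  rw [refEigenvalue, aFun_sub_eta, dFun_self, prod_Icc_one_eq_prod_range,
    prod_Icc_one_eq_prod_range, Finset.prod_range_succ']
  have : ∀ r ∈ Finset.range m, dFun ξ (ξ a - η - ((r + 1 : ℕ) : ℂ) * η) =
      dFun ξ (ξ a - ((r + 1 + 1 : ℕ) : ℂ) * η) := fun r _ => by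
    congr 1; push_cast; ring
  rw [Finset.prod_congr rfl this]
  simp
  ring

theorem gFun_eq (m : ℕ) (a : Fin N) (u : ℂ) : gFun η ξ (m + 1) a u =
    (∏ b ∈ Finset.univ.erase a, (u - ξ b) / (ξ a - ξ b)) *
      (∏ r ∈ Finset.Icc 1 m, dFun ξ (ξ a - (r : ℂ) * η))⁻¹ := by
  rw [gFun, ← prod_prod_sub_eq_prod_dFun]
  simp [sub_add_eq_sub_sub]

/-- After the denominators cancel, the sum is `k₁ e_{m+1}` times the interpolation of `a - d`.
Adding the asymptotic term `(k₁ e_{m+1} + e_{m+2}) d` leaves `k₁ e_{m+1} a + e_{m+2} d`. -/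
theorem refEigenvalue_succ_eq_interpolation (m : ℕ) (hg : GenericUpTo η ξ (m + 1 + 1)) (u : ℂ) :
    refEigenvalue η ξ J (m + 1 + 1) u =
      (∏ b, ∏ r ∈ Finset.Icc 1 (m + 1), (u - ξ b - (r : ℂ) * η)) *
        ((J 0 0 * restEsymm J (m + 1) + restEsymm J (m + 1 + 1)) * ∏ b, (u - ξ b) +
          ∑ a, gFun η ξ (m + 1 + 1) a u *
            (refEigenvalue η ξ J 1 (ξ a) * refEigenvalue η ξ J (m + 1) (ξ a - η))) := by
  obtain ⟨hξ, hr⟩ := hg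
  have hinj : Function.Injective ξ := fun a b h => by
    by_contra hab
    exact hξ a b hab h
  have hsum : ∀ a ∈ Finset.univ, gFun η ξ (m + 1 + 1) a u *
      (refEigenvalue η ξ J 1 (ξ a) * refEigenvalue η ξ J (m + 1) (ξ a - η)) =
      (J 0 0 * restEsymm J (m + 1)) *
        ((∏ b ∈ Finset.univ.erase a, (u - ξ b) / (ξ a - ξ b)) * aFun η ξ (ξ a)) := by
    intro a _
    have hne : ∏ r ∈ Finset.Icc 1 (m + 1), dFun ξ (ξ a - (r : ℂ) * η) ≠ 0 := by
      refine Finset.prod_ne_zero_iff.2 fun r hrm => Finset.prod_ne_zero_iff.2 fun b _ h => ?_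
      exact hr a b r hrm (by linear_combination h)
    have h1 : refEigenvalue η ξ J 1 (ξ a) = J 0 0 * aFun η ξ (ξ a) := by
      rw [refEigenvalue, dFun_self, restEsymm_zero]
      simp [mul_comm]
    rw [gFun_eq, h1, refEigenvalue_sub_eta]
    generalize ∏ r ∈ Finset.Icc 1 (m + 1), dFun ξ (ξ a - (r : ℂ) * η) = q at *
    field_simp
  rw [Finset.sum_congr rfl hsum, ← Finset.mul_sum, sum_lagrange_aFun η ξ hinj,
    prod_prod_sub_eq_prod_dFun, refEigenvalue, dFun]
  ring

theorem refEigenvalue_self (hJ : ∀ i j, j < i → J i j = 0) (u : ℂ) :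
    refEigenvalue η ξ J n u = J.det *
      ∏ b, ((u - ξ b + η) * ∏ r ∈ Finset.Icc 1 (n - 1), (u - ξ b - (r : ℂ) * η)) := by
  have hdet : J.det = J 0 0 * restEsymm J (n - 1) := by
    rw [mul_restEsymm_pred]
    exact Matrix.det_of_isUpperTriangular fun i j h => hJ i j h
  have hn : n - 1 + 1 = n := Nat.succ_pred (NeZero.ne n)
  have h : aFun η ξ u = ∏ a, (u - ξ a + η) :=
    Finset.prod_congr rfl fun a _ => by ring
  rw [hdet, Finset.prod_mul_distrib, prod_prod_sub_eq_prod_dFun, ← h]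
  have hself := restEsymm_self J
  have hsucc := refEigenvalue.eq_2 η ξ J u (n - 1)
  rw [Nat.succ_eq_add_one, hn] at hsucc
  rw [hsucc, hself]
  ring

theorem alpha_eq (k : ℂ) (b : ℕ) (u : ℂ) : alpha η ξ k b u =
    (-1) ^ (b + 1) * (k ^ b * ∏ h ∈ Finset.range b, aFun η ξ (u - (h : ℂ) * η)) := by
  cases b with
  | zero => simp [alpha]
  | succ j =>
    rw [alpha, Finset.prod_mul_distrib, Finset.prod_const, Finset.card_range]
    ring

theorem quantumSpectralCurve_refEigenvalue :
    QuantumSpectralCurve n η ξ (J 0 0) (fun _ => 1) (refEigenvalue η ξ J) := by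
  intro u
  let d : ℕ → ℂ := fun i => aFun η ξ (u - (i : ℂ) * η)
  -- The product in `f b` runs over `d 0, …, d n` with `d b` omitted. The two terms of the
  -- eigenvalue in the `b`-th summand omit `d b` and `d (b + 1)`, which makes the sum telescope.
  let f : ℕ → ℂ := fun b => (-1) ^ (b + 1) * (J 0 0 ^ b * restEsymm J (n - b) *
    (∏ h ∈ Finset.range b, d h) * ∏ i ∈ Finset.range (n - b), d (b + 1 + i))
  have hd : ∀ i : ℕ, dFun ξ (u - (i : ℂ) * η) = d (i + 1) := fun i => by
    rw [← aFun_sub_eta η]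
    simp only [d]
    congr 1; push_cast; ring
  have key : ∀ b ∈ Finset.range n, alpha η ξ (J 0 0) b u * 1 *
      refEigenvalue η ξ J (n - b) (u - (b : ℂ) * η) = f b - f (b + 1) := by
    intro b hb
    obtain ⟨m, rfl⟩ := Nat.exists_eq_add_of_lt (Finset.mem_range.1 hb)
    have e1 : b + m + 1 - b = m + 1 := by omega
    have e2 : b + m + 1 - (b + 1) = m := by omega
    have hp : ∏ r ∈ Finset.Icc 1 m, dFun ξ (u - (b : ℂ) * η - (r : ℂ) * η) =
        ∏ i ∈ Finset.range m, d (b + 1 + 1 + i) := by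
      rw [prod_Icc_one_eq_prod_range]
      refine Finset.prod_congr rfl fun i _ => ?_
      rw [show b + 1 + 1 + i = b + (i + 1) + 1 by ring, ← hd]
      congr 1; push_cast; ring
    have hp' : ∏ i ∈ Finset.range (m + 1), d (b + 1 + i) =
        (∏ i ∈ Finset.range m, d (b + 1 + 1 + i)) * d (b + 1) := by
      rw [Finset.prod_range_succ']
      congr 1
      exact Finset.prod_congr rfl fun i _ => by congr 1; ring
    simp only [f, e1, e2]
    rw [alpha_eq, refEigenvalue, hp, hp', hd, Finset.prod_range_succ]
    simp only [d]
    ring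
  -- The summand `b = n` involves `t 0 = 1` and equals `f n`; the others telescope to `f 0 - f n`,
  -- and `f 0 = 0` because `e_n = 0`.
  rw [Finset.sum_range_succ]
  simp only
  rw [Finset.sum_congr rfl key, Finset.sum_range_sub', Nat.sub_self, alpha_eq, refEigenvalue]
  simp only [f, d, Nat.sub_self, Nat.sub_zero, restEsymm_self, restEsymm_zero, Finset.range_zero,
    Finset.prod_empty]
  ring

theorem refVector_ne_zero {W : Matrix (Fin n) (Fin n) ℂ} (hW : IsUnit W.det) :
    refVector N W ≠ 0 := by
  intro h
  have h' := congrArg (gammaOp N W⁻¹).mulVec h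
  rw [refVector, Matrix.mulVec_mulVec, gammaOp_mul, Matrix.nonsing_inv_mul W hW, gammaOp_one,
    Matrix.one_mulVec, Matrix.mulVec_zero, tensorVec_e₁] at h'
  simpa using congrFun h' 0

theorem transfer_mulVec_refVector {J K W : Matrix (Fin n) (Fin n) ℂ} (hW : IsUnit W.det)
    (hKJ : W * J = K * W) (hJ : ∀ i j, j < i → J i j = 0) (m : ℕ) (u : ℂ) :
    (transfer η ξ K (m + 1) u).mulVec (refVector N W) =
      refEigenvalue η ξ J (m + 1) u • refVector N W := by
  rw [refVector, Matrix.mulVec_mulVec, transfer_mul_gammaOp hKJ (Matrix.nonsing_inv_mul W hW),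
    ← Matrix.mulVec_mulVec, transfer_mulVec_of_upperTriangular η ξ u hJ, Matrix.mulVec_smul]

end SpectralCurve

end GLChain

/-! ### Assembly of the theorem -/

open GLChain
theorem lemma5p1 {n N : ℕ} [NeZero n] (η : ℂ) (ξ : Fin N → ℂ)
    (K J W : Matrix (Fin n) (Fin n) ℂ) (k₁ : ℂ)
    (hK : WSimple K) (hJ : IsJordanForm J) (hW : IsUnit W.det) (hKJ : K = W * J * W⁻¹)
    (hk : J.mulVec e₁ = k₁ • e₁) (hk₁ : k₁ ≠ 0) :
    refVector N W ≠ 0 ∧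
    ∃ t : ℕ → ℂ → ℂ,
      (∀ u, t 0 u = 1) ∧
      (∀ u, t 1 u = k₁ * ∏ a, (u - ξ a + η) + (K.trace - k₁) * ∏ a, (u - ξ a)) ∧
      (∀ m, 1 ≤ m → m ≤ n → ∀ u,
        (transfer η ξ K m u).mulVec (refVector N W) = t m u • refVector N W) ∧
      (∀ m, 1 ≤ m → m + 1 ≤ n → GenericUpTo η ξ (m + 1) → ∀ u,
        t (m + 1) u =
          (∏ b, ∏ r ∈ Finset.Icc 1 m, (u - ξ b - (r : ℂ) * η)) *
            (transferInfty K (m + 1) * ∏ b, (u - ξ b) +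
              ∑ a, gFun η ξ (m + 1) a u * (t 1 (ξ a) * t m (ξ a - η)))) ∧
      (∀ u, t n u = K.det *
        ∏ b, ((u - ξ b + η) * ∏ r ∈ Finset.Icc 1 (n - 1), (u - ξ b - (r : ℂ) * η))) ∧
      QuantumSpectralCurve n η ξ k₁ (fun _ => 1) t := by
  have hJ0 := hJ.apply_eq_zero_of_lt
  -- The first coordinate of the eigenvector equation identifies `k₁` with the corner entry, in
  -- terms of which `refEigenvalue` is written.
  have hk00 : J 0 0 = k₁ := by simpa [e₁] using congrFun hk 0
  have hWJ : W * J = K * W := by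
    rw [hKJ, mul_assoc, Matrix.nonsing_inv_mul W hW, mul_one]
  have htr : K.trace = J.trace := by
    rw [hKJ, Matrix.trace_mul_comm, ← mul_assoc, Matrix.nonsing_inv_mul W hW, one_mul]
  have hdet : K.det = J.det := by
    have := congrArg Matrix.det hWJ
    rw [Matrix.det_mul, Matrix.det_mul, mul_comm] at this
    exact (hW.mul_right_cancel this).symm
  subst hk00
  refine ⟨refVector_ne_zero hW, refEigenvalue η ξ J, fun _ => rfl, ?_, ?_, ?_, ?_,
    quantumSpectralCurve_refEigenvalue η ξ J⟩
  · intro u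
    rw [refEigenvalue_one, htr]
  · intro m hm _ u
    obtain ⟨m, rfl⟩ := Nat.exists_eq_add_of_le' hm
    exact transfer_mulVec_refVector η ξ hW hWJ hJ0 m u
  · intro m hm _ hg u
    obtain ⟨m, rfl⟩ := Nat.exists_eq_add_of_le' hm
    rw [transferInfty_succ hWJ (Matrix.nonsing_inv_mul W hW) hJ0]
    exact refEigenvalue_succ_eq_interpolation η ξ J m hg u
  · intro u
    rw [refEigenvalue_self η ξ J hJ0, hdet]
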